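/- **Definitions.** Let $K$ be a field of characteristic $0$ (for instance $K=\mathbb C$). Let $P$ be the set of all partitions (of all integers $n\ge 0$). For $\lambda\in P$ let $m_i(\lambda)$ be the multiplicity of the part $i$ in $\lambda$ and $\ell(\lambda)$ the number of parts. Let $\lambda^r$ be the strict partition (no repeated parts) in which $i$ has multiplicity $1$ if $m_i(\lambda)$ is odd and $0$ if $m_i(\lambda)$ is even, and let $\lambda^d$ be the partition in which $i$ has multiplicity $\lfloor m_i(\lambda)/2\rfloor$. Let $S_\lambda(x)$ be the Schur function of $\lambda$ in the variables $x=(x_1,x_2,\dots)$, i.e. $S_\lambda(x)=\sum_T x^T$ over all semistandard Young tableaux $T$ of shape $\lambda$. For a strict partition $\mu$ let $Q_\mu(x)$ be Schur's $Q$-function, i.e. $Q_\mu(x)=\sum_T x^{|T|}$ over all marked shifted tableaux $T$ of shifted shape $\mu$ (marks on the main diagonal allowed), and let $P_\mu(x)=2^{-\ell(\mu)}Q_\mu(x)$. Put $x^2=(x_1^2,x_2^2,\dots)$ and $$W_\lambda(x)=Q_{\lambda^r}(x)\,S_{\lambda^d}(x^2),\qquad V_\lambda(x)=P_{\lambda^r}(x)\,S_{\lambda^d}(x^2)\qquad(\lambda\in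 P).$$ **Proposition 4.1.** In the ring of formal power series over $K$ in the variables $x_1,x_2,\dots$ and $y_1,y_2,\dots$, the following product and sum converge unconditionally, coefficient by coefficient (for every Hausdorff topology on $K$, in particular for the discrete one), and $$\prod_{i,j\ge 1}\frac{1}{(1-x_iy_j)^2}=\sum_{\lambda\in P}W_\lambda(x)\,V_\lambda(y).$$ -/

import Mathlib

open scoped MvPowerSeries.WithPiTopology

noncomputable section

namespace CompoundBasis

/-- The set `P` of all partitions (of all integers `n ≥ 0`). -/
abbrev Ptn : Type := Σ n : ℕ, n.Partition

/-- The set `SP` of all strict partitions: no part is repeated. -/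
abbrev StrictPtn : Type := {l : Ptn // l.2.parts.Nodup}

/-- The parts `λ₁ ≥ λ₂ ≥ …` of a partition as a weakly decreasing list. -/
def rows (l : Ptn) : List ℕ := l.2.parts.sort (· ≥ ·)

theorem rows_sortedGE (l : Ptn) : (rows l).SortedGE :=
  (Multiset.pairwise_sort l.2.parts (· ≥ ·)).sortedGE

/-- The length `ℓ(λ)`: the number of parts. -/
def len (l : Ptn) : ℕ := Multiset.card l.2.parts

/-- The strict partition `λʳ`: each `i` with odd multiplicity `mᵢ(λ)` occurs exactly once,
and no other part occurs. -/
def redPart (l : Ptn) : StrictPtn :=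
  ⟨⟨_, { parts := (l.2.parts.toFinset.filter fun i => Odd (l.2.parts.count i)).val
         parts_pos := fun {_} hi =>
          l.2.parts_pos (Multiset.mem_toFinset.1 (Finset.mem_filter.1 hi).1)
         parts_sum := rfl }⟩, Finset.nodup _⟩

/-- The partition `λᵈ`: each `i` has multiplicity `⌊mᵢ(λ) / 2⌋`, that is `(mᵢ(λ) - 1) / 2` if
`mᵢ(λ)` is odd and `mᵢ(λ) / 2` if it is even. -/
def doublePart (l : Ptn) : Ptn :=
  ⟨_, { parts := ∑ i ∈ l.2.parts.toFinset, Multiset.replicate (l.2.parts.count i / 2) i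
        parts_pos := fun {_} hi => by
          obtain ⟨i, hi, h⟩ := Multiset.mem_sum.1 hi
          rw [Multiset.eq_of_mem_replicate h]
          exact l.2.parts_pos (Multiset.mem_toFinset.1 hi)
        parts_sum := rfl }⟩

/-- The Young diagram of a partition. -/
def diagram (l : Ptn) : YoungDiagram := YoungDiagram.ofRowLens (rows l) (rows_sortedGE l)

/-- The content (exponent vector of `x^T`) of a semistandard tableau: `i ↦` number of cells with
entry `i`. -/
def ssytContent {m : YoungDiagram} (T : SemistandardYoungTableau m) : ℕ →₀ ℕ :=
  ∑ c ∈ m.cells, Finsupp.single (T c.1 c.2) 1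

/-- The Schur function `S_λ(x) = ∑_T x^T`, the sum over all semistandard Young tableaux of shape
`λ`, as a formal power series in the variables `x₀, x₁, x₂, …`. -/
def schurS (K : Type*) [Field K] (l : Ptn) : MvPowerSeries ℕ K :=
  fun e => (Nat.card {T : SemistandardYoungTableau (diagram l) // ssytContent T = e} : K)

/-- The shifted diagram of a strict partition: row `i` is moved `i` steps to the right, so that it
consists of the cells `(i, j)` with `i ≤ j < i + λᵢ` (rows and columns are numbered from `0`). -/
def shiftedCells (l : StrictPtn) : Finset (ℕ × ℕ) :=
  (Finset.range (len l.1)).biUnion fun i =>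
    (Finset.Ico i (i + (rows l.1).getD i 0)).image fun j => (i, j)

/-- Marked shifted tableaux of shape `λ`. The ordered alphabet `0' < 0 < 1' < 1 < 2' < 2 < ⋯` is
encoded by the natural numbers: `2k` is the marked letter `k'` and `2k + 1` is the unmarked letter
`k`. Rows and columns weakly increase, every row contains each marked letter at most once, every
column contains each unmarked letter at most once. For extensionality the filling is `0`
outside the shifted diagram. -/
structure MarkedShiftedTableau (l : StrictPtn) where
  /-- the letter in row `i` and column `j` -/
  entry : ℕ → ℕ → ℕ
  row_weak : ∀ i j₁ j₂, j₁ < j₂ → (i, j₁) ∈ shiftedCells l → (i, j₂) ∈ shiftedCells l →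
    entry i j₁ ≤ entry i j₂
  col_weak : ∀ i₁ i₂ j, i₁ < i₂ → (i₁, j) ∈ shiftedCells l → (i₂, j) ∈ shiftedCells l →
    entry i₁ j ≤ entry i₂ j
  row_marked : ∀ i j₁ j₂, j₁ < j₂ → (i, j₁) ∈ shiftedCells l → (i, j₂) ∈ shiftedCells l →
    Even (entry i j₁) → entry i j₁ ≠ entry i j₂
  col_unmarked : ∀ i₁ i₂ j, i₁ < i₂ → (i₁, j) ∈ shiftedCells l → (i₂, j) ∈ shiftedCells l →
    Odd (entry i₁ j) → entry i₁ j ≠ entry i₂ j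
  zeros : ∀ i j, (i, j) ∉ shiftedCells l → entry i j = 0

/-- The content of a marked shifted tableau: `k ↦` number of cells with letter `k'` or `k`. -/
def mstContent {l : StrictPtn} (T : MarkedShiftedTableau l) : ℕ →₀ ℕ :=
  ∑ c ∈ shiftedCells l, Finsupp.single (T.entry c.1 c.2 / 2) 1

/-- Schur's `Q`-function `Q_λ(x) = ∑_T x^{|T|}` of a strict partition, the sum over all marked
shifted tableaux of shape `λ` (marks on the main diagonal are allowed). -/
def schurQ (K : Type*) [Field K] (l : StrictPtn) : MvPowerSeries ℕ K :=
  fun e => (Nat.card {T : MarkedShiftedTableau l // mstContent T = e} : K)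

/-- Schur's `P`-function `P_λ = 2^{-ℓ(λ)} Q_λ`. -/
def schurP (K : Type*) [Field K] (l : StrictPtn) : MvPowerSeries ℕ K :=
  ((2 : K) ^ len l.1)⁻¹ • schurQ K l

/-- `W_λ(x) = Q_{λʳ}(x) S_{λᵈ}(x²)`, where `x² = (x₀², x₁², …)`. -/
def W (K : Type*) [Field K] (l : Ptn) : MvPowerSeries ℕ K :=
  schurQ K (redPart l) * MvPowerSeries.expand 2 two_ne_zero (schurS K (doublePart l))

/-- `V_λ(x) = P_{λʳ}(x) S_{λᵈ}(x²)`. -/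
def V (K : Type*) [Field K] (l : Ptn) : MvPowerSeries ℕ K :=
  schurP K (redPart l) * MvPowerSeries.expand 2 two_ne_zero (schurS K (doublePart l))

/-- `f ↦ f(x)`: rename the variables to the first alphabet `xᵢ = X (Sum.inl i)`. -/
def inX {K : Type*} [Field K] (f : MvPowerSeries ℕ K) : MvPowerSeries (ℕ ⊕ ℕ) K :=
  MvPowerSeries.rename (Function.Embedding.inl : ℕ ↪ ℕ ⊕ ℕ) f

/-- `f ↦ f(y)`: rename the variables to the second alphabet `yⱼ = X (Sum.inr j)`. -/
def inY {K : Type*} [Field K] (f : MvPowerSeries ℕ K) : MvPowerSeries (ℕ ⊕ ℕ) K :=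
  MvPowerSeries.rename (Function.Embedding.inr : ℕ ↪ ℕ ⊕ ℕ) f

end CompoundBasis

end

open scoped MvPowerSeries.WithPiTopology

noncomputable section

namespace CompoundBasis

open Finset

/-! With `t = xᵢyⱼ` one has `(1 - t)⁻² = (1 + t)/(1 - t) · 1/(1 - t²)`. The product of the first
factors is the Cauchy kernel of `∑ Q_μ(x) P_μ(y)` over strict partitions, and the product of the
second factors is the Schur kernel `∑ S_ν(x) S_ν(y)` with all variables squared. Multiplying the two
sums and reindexing by the bijection `λ ↦ (λʳ, λᵈ)`, which is division with remainder by 2 on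
multiplicities, gives the result.

Both Cauchy identities come from one argument. Splitting a tableau according to its letters turns
the generating function into a sum over chains of strips, that is, an iterate of operators `U(xᵢ)`
that add a strip of weight `xᵢ^size`. If `D(y)` removes strips and `D(y) U(x) = k(xy) U(x) D(y)`,
then moving every `D(yⱼ)` past every `U(xᵢ)` produces `∏ k(xᵢyⱼ)`; this is
`mk_sum_chainSum_mul_chainSum`. It remains to prove the commutation relation in the two cases.

For Schur functions, `k(t) = 1/(1 - t)`. Given two partitions, row `i + 1` of a common upper
neighbour and row `i` of a common lower neighbour range over the same interval, and reflecting in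
this interval matches them. Only the first row of the upper neighbour is unbounded, and its excess
yields the geometric series (`stripCommute_stripWeight`).

For `Q` and `P`, `k(t) = (1 + t)/(1 - t)`. The strips with letters `a'` and `a` together join
interlacing strict partitions `A`, `B`, with weight `2^|A \ B|` for `Q` (`sum_between`) and `2^|B \
A|` for `P`. These are row weights of a six-vertex model whose columns record which parts are
present. A column-by-column Yang–Baxter argument (`sumDown_sumUp_yangBaxter`) compares the sums over
common upper and common lower neighbours, up to a boundary term that tends to zero as columns are
added (`stripCommute_int`).

Passing to infinitely many variables is coefficientwise: a monomial involves finitely many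
variables, and homogeneity leaves finitely many shapes. Convergence is established for the discrete
topology on `K`, hence holds for every topology. -/

/-- A graded set with finitely many elements in each degree. -/
class GradedFinite (P : Type*) where
  /-- the degree -/
  deg : P → ℕ
  finite_deg : ∀ n, {l | deg l = n}.Finite

/-! ### Abstract Cauchy identity from commuting strip operators -/

section Graded

variable {P R : Type*} [GradedFinite P] [CommRing R]

open GradedFinite

/-- The elements of degree `n`. -/
def level (P : Type*) [GradedFinite P] (n : ℕ) : Finset P :=
  (finite_deg (P := P) n).toFinset

@[simp]
theorem mem_level {n : ℕ} {l : P} : l ∈ level P n ↔ deg l = n := by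
  simp [level]

/-- The operator that adds a strip, weighted by `A` and by `x` to the size of the strip. -/
def raise (A : P → P → R) (x : R) (F : P → R) (l : P) : R :=
  ∑ p ∈ antidiagonal (deg l), x ^ p.2 * ∑ m ∈ level P p.1, A l m * F m

/-- The commutation relation between the operators adding and removing strips, with
kernel `∑ kⱼ tʲ`. -/
def StripCommute (A B : P → P → R) (k : ℕ → R) : Prop :=
  ∀ m n s, ∑ l ∈ level P (deg n + s), A l m * B l n =
    ∑ j ∈ antidiagonal s, k j.1 * ∑ i ∈ antidiagonal (deg n), ∑ r ∈ level P i.1,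
      if i.1 + j.2 = deg m then A n r * B m r else 0

/-- The hypothesis `hF` says that `F` is an eigenvector of the strip-removing operator with
eigenvalue series `h`. Commuting that operator past `raise A x` keeps this property and multiplies
the eigenvalue by the kernel rescaled by `x`. -/
theorem lower_raise {A B : P → P → R} {k : ℕ → R} (hAB : StripCommute A B k)
    {F : P → R} {h : ℕ → R}
    (hF : ∀ n s, ∑ l ∈ level P (deg n + s), B l n * F l = h s * F n) (x : R) (n : P) (s : ℕ) :
    ∑ l ∈ level P (deg n + s), B l n * raise A x F l =
      (∑ p ∈ antidiagonal s, k p.1 * x ^ p.1 * h p.2) * raise A x F n := by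
  have e1 : ∑ l ∈ level P (deg n + s), B l n * raise A x F l =
      ∑ p ∈ antidiagonal (deg n + s), x ^ p.2 * ∑ m ∈ level P p.1,
        F m * ∑ l ∈ level P (deg n + s), A l m * B l n := by
    have : ∀ l ∈ level P (deg n + s), B l n * raise A x F l =
        ∑ p ∈ antidiagonal (deg n + s), x ^ p.2 * ∑ m ∈ level P p.1, F m * (A l m * B l n) := by
      intro l hl
      rw [mem_level] at hl
      simp only [raise, hl, mul_sum]
      refine sum_congr rfl fun p _ => sum_congr rfl fun m _ => by ring
    rw [sum_congr rfl this, sum_comm]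
    refine sum_congr rfl fun p _ => ?_
    rw [← mul_sum, sum_comm]
    simp only [mul_sum]
  rw [e1]
  have e2 : ∀ p ∈ antidiagonal (deg n + s), x ^ p.2 * ∑ m ∈ level P p.1,
      F m * ∑ l ∈ level P (deg n + s), A l m * B l n =
      ∑ j ∈ antidiagonal s, ∑ i ∈ antidiagonal (deg n),
        if i.1 + j.2 = p.1 then
          x ^ p.2 * k j.1 * ∑ r ∈ level P i.1, A n r * ∑ m ∈ level P p.1, B m r * F m else 0 := by
    intro p _
    have : ∀ m ∈ level P p.1, F m * ∑ l ∈ level P (deg n + s), A l m * B l n =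
        ∑ j ∈ antidiagonal s, ∑ i ∈ antidiagonal (deg n),
          if i.1 + j.2 = p.1 then
            k j.1 * ∑ r ∈ level P i.1, A n r * (B m r * F m) else 0 := by
      intro m hm
      rw [hAB, mul_sum]
      refine sum_congr rfl fun j _ => ?_
      rw [mul_sum, mul_sum]
      refine sum_congr rfl fun i _ => ?_
      rw [mem_level] at hm
      rw [hm]
      split_ifs with hi
      · rw [mul_sum, mul_sum, mul_sum]
        refine sum_congr rfl fun r _ => by ring
      · simp
    rw [sum_congr rfl this, sum_comm, mul_sum]
    refine sum_congr rfl fun j _ => ?_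
    rw [sum_comm, mul_sum]
    refine sum_congr rfl fun i _ => ?_
    split_ifs with hi
    · rw [← mul_sum, sum_comm, mul_assoc]
      simp only [mul_sum]
    · simp
  rw [sum_congr rfl e2, sum_comm, sum_mul]
  refine sum_congr rfl fun j hj => ?_
  rw [sum_comm, raise, mul_sum]
  refine sum_congr rfl fun i hi => ?_
  rw [HasAntidiagonal.mem_antidiagonal] at hj hi
  -- Degrees determine the middle level: the removed strip has size `j.2`, and the total degree is
  -- `deg n + s`.
  rw [sum_eq_single (i.1 + j.2, i.2 + j.1)]
  · simp only [if_true]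
    have : ∀ r ∈ level P i.1, A n r * ∑ m ∈ level P (i.1 + j.2), B m r * F m =
        h j.2 * (A n r * F r) := by
      intro r hr
      rw [mem_level] at hr
      rw [← hr, hF]; ring
    rw [sum_congr rfl this, ← mul_sum, pow_add]
    ring
  · intro p hp hne
    rw [HasAntidiagonal.mem_antidiagonal] at hp
    rw [if_neg]
    intro h1
    apply hne
    ext <;> simp <;> omega
  · intro hn
    exfalso; apply hn
    rw [HasAntidiagonal.mem_antidiagonal]; simp only; omega

/-- The generating function of chains of `n` strips starting from degree zero. -/
def chainSum (A : P → P → R) (x : ℕ → R) : ℕ → P → R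
  | 0 => fun l => if deg l = 0 then 1 else 0
  | n + 1 => raise A (x n) (chainSum A x n)

theorem chainSum_of_deg_eq_zero {A : P → P → R} {o : P} (ho : ∀ l, deg l = 0 ↔ l = o)
    (hA : A o o = 1) (x : ℕ → R) (n : ℕ) : chainSum A x n o = 1 := by
  have h0 : level P 0 = {o} := by ext l; simp [ho]
  have h1 : deg o = 0 := (ho o).2 rfl
  induction n with
  | zero => simp [chainSum, h1]
  | succ n ih => simp [chainSum, raise, h1, h0, hA, ih]

/-- Each of the `N` raising operators contributes one kernel factor by `lower_raise`. The start of
the chain, concentrated in degree zero, has eigenvalue 1. -/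
theorem lower_chainSum {A B : P → P → R} {k : ℕ → R} (hAB : StripCommute A B k) {o : P}
    (ho : ∀ l, deg l = 0 ↔ l = o) (hB : B o o = 1) (x : ℕ → R) (N : ℕ) (n : P) (s : ℕ) :
    ∑ l ∈ level P (deg n + s), B l n * chainSum A x N l =
      PowerSeries.coeff s (∏ i ∈ range N, PowerSeries.rescale (x i) (PowerSeries.mk k)) *
        chainSum A x N n := by
  have h0 : level P 0 = {o} := by ext l; simp [ho]
  have h1 : deg o = 0 := (ho o).2 rfl
  induction N generalizing n s with
  | zero =>
    simp only [chainSum, range_zero, prod_empty, PowerSeries.coeff_one]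
    by_cases hs : s = 0
    · subst hs
      by_cases hn : deg n = 0
      · rw [(ho n).1 hn]
        simp [h0, h1, hB]
      · rw [sum_eq_zero]
        · simp [hn]
        · intro l hl
          rw [mem_level] at hl
          rw [if_neg (by omega), mul_zero]
    · rw [sum_eq_zero]
      · simp [hs]
      · intro l hl
        rw [mem_level] at hl
        rw [if_neg (by omega), mul_zero]
  | succ N ih =>
    rw [chainSum, lower_raise hAB ih, prod_range_succ, mul_comm (∏ i ∈ range N, _),
      PowerSeries.coeff_mul]
    congr 1
    refine sum_congr rfl fun p _ => ?_
    simp only [PowerSeries.coeff_rescale, PowerSeries.coeff_mk]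
    ring

/-- Induction on the number of `y` variables: the last strip of the `y`-chain is read as an operator
removing a strip from the `x`-chain, where `lower_chainSum` evaluates it. The power series variable
records the degree of the common final shape. -/
theorem mk_sum_chainSum_mul_chainSum {A B : P → P → R} {k : ℕ → R} (hAB : StripCommute A B k)
    {o : P} (ho : ∀ l, deg l = 0 ↔ l = o) (hA : A o o = 1) (hB : B o o = 1) (x y : ℕ → R)
    (N M : ℕ) :
    PowerSeries.mk (fun n => ∑ l ∈ level P n, chainSum A x N l * chainSum B y M l) =
      ∏ j ∈ range M, ∏ i ∈ range N, PowerSeries.rescale (x i * y j) (PowerSeries.mk k) := by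
  have h0 : level P 0 = {o} := by ext l; simp [ho]
  induction M with
  | zero =>
    ext n
    simp only [range_zero, prod_empty, PowerSeries.coeff_one, PowerSeries.coeff_mk]
    split_ifs with hn
    · subst hn
      simp [h0, chainSum_of_deg_eq_zero ho hA, chainSum_of_deg_eq_zero ho hB]
    · refine sum_eq_zero fun l hl => ?_
      rw [mem_level] at hl
      simp only [chainSum]
      rw [if_neg (by omega), mul_zero]
  | succ M ih =>
    rw [prod_range_succ, ← ih]
    have : ∏ i ∈ range N, PowerSeries.rescale (x i * y M) (PowerSeries.mk k) =
        PowerSeries.rescale (y M)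
          (∏ i ∈ range N, PowerSeries.rescale (x i) (PowerSeries.mk k)) := by
      rw [map_prod]
      refine prod_congr rfl fun i _ => ?_
      ext n
      simp only [PowerSeries.coeff_rescale, mul_pow]
      ring
    rw [this]
    ext n
    rw [PowerSeries.coeff_mul, PowerSeries.coeff_mk]
    have e1 : ∀ l ∈ level P n, chainSum A x N l * chainSum B y (M + 1) l =
        ∑ p ∈ antidiagonal n, y M ^ p.2 * ∑ m ∈ level P p.1,
          chainSum B y M m * (B l m * chainSum A x N l) := by
      intro l hl
      rw [mem_level] at hl
      simp only [chainSum, raise, hl, mul_sum]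
      refine sum_congr rfl fun p _ => sum_congr rfl fun m _ => by ring
    rw [sum_congr rfl e1, sum_comm]
    refine sum_congr rfl fun p hp => ?_
    rw [HasAntidiagonal.mem_antidiagonal] at hp
    rw [← mul_sum, sum_comm, PowerSeries.coeff_mk, PowerSeries.coeff_rescale]
    have e2 : ∀ m ∈ level P p.1, ∑ l ∈ level P n,
        chainSum B y M m * (B l m * chainSum A x N l) = chainSum B y M m *
        (PowerSeries.coeff p.2
          (∏ i ∈ range N, PowerSeries.rescale (x i) (PowerSeries.mk k)) * chainSum A x N m) := by
      intro m hm
      rw [mem_level] at hm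
      rw [← mul_sum, ← hp, ← hm, lower_chainSum hAB ho hB]
    rw [sum_congr rfl e2, mul_sum, sum_mul]
    refine sum_congr rfl fun m _ => by ring

end Graded

/-! ### Tableaux as chains of strips -/

open GradedFinite in
/-- Fillings of diagrams that are built up letter by letter: the cells with letter `a` form a strip
of a kind depending on `a`. -/
structure TableauSystem (P : Type*) [GradedFinite P] where
  /-- the diagram of a shape -/
  cells : P → Finset (ℕ × ℕ)
  card_cells : ∀ l, (cells l).card = deg l
  cells_injective : Function.Injective cells
  /-- the fillings that are tableaux of a given shape -/
  IsTab : P → (ℕ → ℕ → ℕ) → Prop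
  /-- the pairs of shapes that differ by a strip filled with a given letter -/
  Strip : ℕ → P → P → Prop
  zeros : ∀ {l T}, IsTab l T → ∀ i j, (i, j) ∉ cells l → T i j = 0
  cells_subset : ∀ {a l m}, Strip a l m → cells m ⊆ cells l
  restrict : ∀ {a l T}, IsTab l T → (∀ c ∈ cells l, T c.1 c.2 < a + 1) →
    ∃ m, Strip a l m ∧ cells m = (cells l).filter (fun c => T c.1 c.2 < a) ∧
      IsTab m (fun i j => if (i, j) ∈ cells m then T i j else 0)
  extend : ∀ {a l m T}, Strip a l m → IsTab m T → (∀ c ∈ cells m, T c.1 c.2 < a) →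
    IsTab l (fun i j => if (i, j) ∈ cells m then T i j else if (i, j) ∈ cells l then a else 0)

namespace TableauSystem

variable {P R : Type*} [GradedFinite P] [CommRing R] (S : TableauSystem P)

theorem finite_bounded (a : ℕ) (l : P) :
    {T | S.IsTab l T ∧ ∀ c ∈ S.cells l, T c.1 c.2 < a}.Finite := by
  classical
  refine (Set.finite_range (fun (f : S.cells l → Fin a) (i j : ℕ) =>
    if h : (i, j) ∈ S.cells l then (f ⟨(i, j), h⟩ : ℕ) else 0)).subset ?_
  rintro T ⟨hT, hb⟩
  refine ⟨fun c => ⟨T c.1.1 c.1.2, hb _ c.2⟩, ?_⟩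
  funext i j
  by_cases h : (i, j) ∈ S.cells l
  · simp [h]
  · simp [h, S.zeros hT i j h]

/-- The tableaux of shape `l` with letters smaller than `a`. -/
def bounded (a : ℕ) (l : P) : Finset (ℕ → ℕ → ℕ) := (S.finite_bounded a l).toFinset

variable {S} in
theorem mem_bounded {a : ℕ} {l : P} {T : ℕ → ℕ → ℕ} :
    T ∈ S.bounded a l ↔ S.IsTab l T ∧ ∀ c ∈ S.cells l, T c.1 c.2 < a := by
  simp [bounded]

/-- The generating function of the tableaux of shape `l` with letters smaller than `a`. -/
def genSum (z : ℕ → R) (a : ℕ) (l : P) : R :=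
  ∑ T ∈ S.bounded a l, ∏ c ∈ S.cells l, z (T c.1 c.2)

-- Erasing the cells with the largest letter `a` and refilling them are inverse to each other. The
-- strip itself carries no choice, so it only contributes a power of `z a`.
open Classical in
theorem sum_bounded_filter (z : ℕ → R) {a : ℕ} {l m : P} (h : S.Strip a l m) :
    ∑ T ∈ (S.bounded (a + 1) l).filter
        (fun T => S.cells m = (S.cells l).filter (fun c => T c.1 c.2 < a)),
      ∏ c ∈ S.cells l, z (T c.1 c.2) =
    z a ^ ((S.cells l).card - (S.cells m).card) * S.genSum z a m := by
  rw [genSum, mul_sum]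
  refine sum_bij' (fun T _ i j => if (i, j) ∈ S.cells m then T i j else 0)
    (fun T _ i j => if (i, j) ∈ S.cells m then T i j else if (i, j) ∈ S.cells l then a else 0)
    ?_ ?_ ?_ ?_ ?_
  · intro T hT
    rw [mem_filter, mem_bounded] at hT
    obtain ⟨⟨hT, hb⟩, hm⟩ := hT
    obtain ⟨m', -, hm', ht⟩ := S.restrict hT hb
    obtain rfl : m = m' := S.cells_injective (hm.trans hm'.symm)
    rw [mem_bounded]
    refine ⟨ht, fun c hc => ?_⟩
    simp only [Prod.mk.eta, hc, if_true]
    rw [hm, mem_filter] at hc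
    exact hc.2
  · intro T hT
    rw [mem_bounded] at hT
    rw [mem_filter, mem_bounded]
    refine ⟨⟨S.extend h hT.1 hT.2, fun c hc => ?_⟩, ?_⟩
    · simp only [Prod.mk.eta]
      split_ifs with h1
      · exact (hT.2 c h1).trans (Nat.lt_succ_self _)
      · exact Nat.lt_succ_self _
    · ext c
      simp only [mem_filter, Prod.mk.eta]
      constructor
      · intro hc
        simp only [hc, if_true]
        exact ⟨S.cells_subset h hc, hT.2 c hc⟩
      · rintro ⟨h1, h2⟩
        by_contra h3
        simp [h1, h3] at h2
  · intro T hT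
    rw [mem_filter, mem_bounded] at hT
    obtain ⟨⟨hT, hb⟩, hm⟩ := hT
    funext i j
    split_ifs with h1 h2
    · simp [h1]
    · have h3 := hb _ h2
      have h4 : ¬ T i j < a := fun h4 => h1 (hm ▸ mem_filter.2 ⟨h2, h4⟩)
      simp only at h3
      omega
    · exact (S.zeros hT i j h2).symm
  · intro T hT
    rw [mem_bounded] at hT
    funext i j
    split_ifs with h1
    · simp [h1]
    · exact (S.zeros hT.1 i j h1).symm
  · intro T hT
    rw [mem_filter, mem_bounded] at hT
    obtain ⟨⟨hT, hb⟩, hm⟩ := hT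
    rw [← prod_sdiff (S.cells_subset h), ← card_sdiff_of_subset (S.cells_subset h),
      ← prod_const]
    congr 1
    · refine prod_congr rfl fun c hc => ?_
      rw [mem_sdiff] at hc
      have h3 := hb _ hc.1
      have h4 : ¬ T c.1 c.2 < a := fun h4 => hc.2 (hm ▸ mem_filter.2 ⟨hc.1, h4⟩)
      congr 1
      omega
    · refine prod_congr rfl fun c hc => ?_
      simp only [Prod.mk.eta, hc, if_true]

-- Tableaux are sorted by the subshape occupied by letters below `a`; this makes adding one letter
-- an application of `raise`, and tableau sums become chain sums.
open Classical in
theorem genSum_succ (z : ℕ → R) (a : ℕ) (l : P) :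
    S.genSum z (a + 1) l =
      raise (fun l m => if S.Strip a l m then 1 else 0) (z a) (S.genSum z a) l := by
  have e : ∀ T ∈ S.bounded (a + 1) l, ∏ c ∈ S.cells l, z (T c.1 c.2) =
      ∑ p ∈ antidiagonal (GradedFinite.deg l), ∑ m ∈ level P p.1,
        if S.cells m = (S.cells l).filter (fun c => T c.1 c.2 < a) then
          ∏ c ∈ S.cells l, z (T c.1 c.2) else 0 := by
    intro T hT
    rw [mem_bounded] at hT
    obtain ⟨m, hs, hm, -⟩ := S.restrict hT.1 hT.2
    have hle := card_le_card (S.cells_subset hs)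
    rw [S.card_cells, S.card_cells] at hle
    -- Exactly one subshape is the set of cells with letters below `a`, so the inserted double sum
    -- has a single nonzero term.
    rw [sum_eq_single (GradedFinite.deg m, GradedFinite.deg l - GradedFinite.deg m)]
    · rw [sum_eq_single m]
      · rw [if_pos hm]
      · intro m' _ hne
        rw [if_neg fun h => hne (S.cells_injective (h.trans hm.symm))]
      · intro h
        simp at h
    · intro p hp hne
      rw [HasAntidiagonal.mem_antidiagonal] at hp
      refine sum_eq_zero fun m' hm' => if_neg fun h => hne ?_
      obtain rfl : m' = m := S.cells_injective (h.trans hm.symm)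
      rw [mem_level] at hm'
      ext <;> simp only <;> omega
    · intro h
      exfalso
      apply h
      rw [HasAntidiagonal.mem_antidiagonal]
      simp only
      omega
  rw [genSum, sum_congr rfl e, sum_comm, raise]
  refine sum_congr rfl fun p hp => ?_
  rw [sum_comm, mul_sum]
  refine sum_congr rfl fun m hm => ?_
  rw [HasAntidiagonal.mem_antidiagonal] at hp
  rw [mem_level] at hm
  rw [← sum_filter]
  split_ifs with h
  · rw [S.sum_bounded_filter z h, S.card_cells, S.card_cells, hm, ← hp, one_mul]
    simp
  · rw [filter_eq_empty_iff.2, sum_empty, zero_mul, mul_zero]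
    intro T hT hm'
    rw [mem_bounded] at hT
    obtain ⟨m', hs, hm'', -⟩ := S.restrict hT.1 hT.2
    obtain rfl : m = m' := S.cells_injective (hm'.trans hm''.symm)
    exact h hs

theorem genSum_zero {o : P} (ho : ∀ l, GradedFinite.deg l = 0 ↔ l = o)
    (hT : S.IsTab o (fun _ _ => 0)) (z : ℕ → R) (l : P) :
    S.genSum z 0 l = if GradedFinite.deg l = 0 then 1 else 0 := by
  split_ifs with h
  · have hc : S.cells l = ∅ := by rw [← card_eq_zero, S.card_cells, h]
    have : S.bounded 0 l = {fun _ _ => 0} := by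
      ext T
      rw [mem_bounded, hc, mem_singleton]
      constructor
      · rintro ⟨h1, -⟩
        funext i j
        exact S.zeros h1 i j (by simp [hc])
      · rintro rfl
        exact ⟨(ho l).1 h ▸ hT, by simp⟩
    rw [genSum, this, sum_singleton, hc, prod_empty]
  · rw [genSum, sum_eq_zero]
    intro T hT
    rw [mem_bounded] at hT
    have : (S.cells l).Nonempty := by
      rw [← card_pos, S.card_cells]; omega
    obtain ⟨c, hc⟩ := this
    exact absurd (hT.2 c hc) (by omega)

/-- The coefficients of the generating function of tableaux count the tableaux of given content. -/
theorem coeff_genSum (K : Type*) [Field K] (w : ℕ → ℕ) (e : ℕ →₀ ℕ) {a : ℕ}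
    (ha : ∀ n, a ≤ n → e (w n) = 0) (l : P) :
    MvPowerSeries.coeff e (S.genSum (fun n => (MvPowerSeries.X (w n) : MvPowerSeries ℕ K)) a l) =
      (Nat.card {T // S.IsTab l T ∧
        ∑ c ∈ S.cells l, Finsupp.single (w (T c.1 c.2)) 1 = e} : K) := by
  classical
  have hX : ∀ T : ℕ → ℕ → ℕ, ∏ c ∈ S.cells l, (MvPowerSeries.X (w (T c.1 c.2)) :
      MvPowerSeries ℕ K) = MvPowerSeries.monomial
        (∑ c ∈ S.cells l, Finsupp.single (w (T c.1 c.2)) 1) 1 := by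
    intro T
    induction S.cells l using Finset.induction_on with
    | empty => simp
    | insert c s hc ih =>
      rw [prod_insert hc, sum_insert hc, ih, MvPowerSeries.X, MvPowerSeries.monomial_mul_monomial,
        one_mul]
  have hset : {T | S.IsTab l T ∧ ∑ c ∈ S.cells l, Finsupp.single (w (T c.1 c.2)) 1 = e} =
      ((S.bounded a l).filter
        (fun T => e = ∑ c ∈ S.cells l, Finsupp.single (w (T c.1 c.2)) 1) : Set _) := by
    ext T
    simp only [Set.mem_ofPred_eq, coe_filter, mem_bounded]
    constructor
    · rintro ⟨h1, h2⟩
      refine ⟨⟨h1, fun c hc => ?_⟩, h2.symm⟩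
      by_contra h3
      -- A letter at or above `a` would give a positive exponent at a variable absent from `e`.
      have h4 := ha _ (not_lt.1 h3)
      rw [← h2, Finsupp.finsetSum_apply, sum_eq_zero_iff] at h4
      simpa using h4 c hc
    · rintro ⟨⟨h1, -⟩, h2⟩
      exact ⟨h1, h2.symm⟩
  rw [genSum, map_sum]
  simp only [hX, MvPowerSeries.coeff_monomial]
  rw [sum_boole]
  congr 1
  rw [← Set.ncard_coe_finset, ← hset]
  rfl

end TableauSystem

/-! ### Horizontal strips and the commutation relation for Schur functions -/

section Young

theorem _root_.YoungDiagram.ext_rowLen {μ ν : YoungDiagram} (h : ∀ i, μ.rowLen i = ν.rowLen i) :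
    μ = ν := by
  ext ⟨i, j⟩
  rw [YoungDiagram.mem_cells, YoungDiagram.mem_cells, YoungDiagram.mem_iff_lt_rowLen,
    YoungDiagram.mem_iff_lt_rowLen, h]

theorem _root_.YoungDiagram.rowLen_le_rowLen_iff {μ ν : YoungDiagram} {i i' : ℕ} :
    μ.rowLen i ≤ ν.rowLen i' ↔ ∀ j, (i, j) ∈ μ → (i', j) ∈ ν := by
  simp only [YoungDiagram.mem_iff_lt_rowLen]
  exact ⟨fun h j hj => hj.trans_le h, fun h => le_of_forall_lt h⟩

theorem _root_.YoungDiagram.rowLen_colLen_zero (μ : YoungDiagram) {N : ℕ} (hN : μ.colLen 0 ≤ N) :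
    μ.rowLen N = 0 := by
  by_contra h
  have : (N, 0) ∈ μ := YoungDiagram.mem_iff_lt_rowLen.2 (Nat.pos_of_ne_zero h)
  rw [YoungDiagram.mem_iff_lt_colLen] at this
  omega

theorem _root_.YoungDiagram.card_eq_sum_rowLen (μ : YoungDiagram) {N : ℕ} (hN : μ.rowLen N = 0) :
    μ.card = ∑ i ∈ range N, μ.rowLen i := by
  rw [YoungDiagram.card, card_eq_sum_card_fiberwise (f := Prod.fst) (t := range N)]
  · refine sum_congr rfl fun i _ => ?_
    rw [YoungDiagram.rowLen_eq_card, YoungDiagram.row]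
  · intro c hc
    rw [mem_coe, mem_range]
    by_contra h
    have h1 := μ.rowLen_anti N c.1 (not_lt.1 h)
    have h2 : c ∈ μ := hc
    rw [← Prod.mk.eta (p := c), YoungDiagram.mem_iff_lt_rowLen] at h2
    omega

theorem _root_.YoungDiagram.lt_card_of_mem {μ : YoungDiagram} {i j : ℕ} (h : (i, j) ∈ μ) :
    i < μ.card ∧ j < μ.card := by
  have h1 : ((range (i + 1)).image fun a => (a, 0)) ⊆ μ.cells := by
    intro c hc
    obtain ⟨a, ha, rfl⟩ := mem_image.1 hc
    exact μ.up_left_mem (Nat.lt_succ_iff.1 (mem_range.1 ha)) (Nat.zero_le _) h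
  have h2 : ((range (j + 1)).image fun a => (0, a)) ⊆ μ.cells := by
    intro c hc
    obtain ⟨a, ha, rfl⟩ := mem_image.1 hc
    exact μ.up_left_mem (Nat.zero_le _) (Nat.lt_succ_iff.1 (mem_range.1 ha)) h
  have h3 := card_le_card h1
  have h4 := card_le_card h2
  rw [card_image_of_injective _ (fun a b h => by simpa using h), card_range] at h3 h4
  exact ⟨h3, h4⟩

instance : GradedFinite YoungDiagram where
  deg := YoungDiagram.card
  finite_deg n := by
    refine Set.Finite.of_finite_image (f := YoungDiagram.cells) ?_
      (fun μ _ ν _ h => YoungDiagram.ext h)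
    refine ((range n ×ˢ range n).powerset.finite_toSet).subset ?_
    rintro _ ⟨μ, rfl, rfl⟩
    rw [mem_coe, mem_powerset]
    rintro ⟨i, j⟩ h
    rw [mem_product, mem_range, mem_range]
    exact YoungDiagram.lt_card_of_mem h

theorem _root_.YoungDiagram.deg_eq (μ : YoungDiagram) : GradedFinite.deg μ = μ.card := rfl

theorem _root_.YoungDiagram.deg_eq_zero (μ : YoungDiagram) : GradedFinite.deg μ = 0 ↔ μ = ⊥ := by
  rw [YoungDiagram.deg_eq, YoungDiagram.card, card_eq_zero]
  exact ⟨fun h => YoungDiagram.ext h, fun h => h ▸ rfl⟩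

/-- The Young diagram with rows of lengths `f 0, …, f (N - 1)`, if these decrease. -/
def youngOfRows (f : ℕ → ℕ) (N : ℕ) : YoungDiagram :=
  open Classical in
  if h : Antitone f then
    { cells := (range N ×ˢ range (f 0)).filter fun c => c.2 < f c.1
      isLowerSet := by
        rintro ⟨i, j⟩ ⟨i', j'⟩ ⟨hi, hj⟩ hm
        have h1 := h hi
        simp only [coe_filter, mem_product, mem_range, Set.mem_ofPred_eq] at hm hi hj h1 ⊢
        omega }
  else ⊥

theorem rowLen_youngOfRows {f : ℕ → ℕ} {N : ℕ} (hf : Antitone f) (hN : f N = 0) (i : ℕ) :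
    (youngOfRows f N).rowLen i = f i := by
  refine eq_of_forall_lt_iff fun j => ?_
  rw [← YoungDiagram.mem_iff_lt_rowLen, youngOfRows, dif_pos hf, ← YoungDiagram.mem_cells, mem_filter,
    mem_product, mem_range, mem_range]
  refine ⟨fun h => h.2, fun h => ⟨⟨?_, ?_⟩, h⟩⟩
  · by_contra h1
    have h2 : f i ≤ f N := hf (not_lt.1 h1)
    omega
  · exact h.trans_le (hf (Nat.zero_le i))

/-- The skew diagram `l / m` is a horizontal strip. -/
def HorizontalStrip (l m : YoungDiagram) : Prop :=
  ∀ i, m.rowLen i ≤ l.rowLen i ∧ l.rowLen (i + 1) ≤ m.rowLen i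

/-- Semistandard Young tableaux, built up letter by letter. -/
def ssytSystem : TableauSystem YoungDiagram where
  cells := YoungDiagram.cells
  card_cells _ := rfl
  cells_injective _ _ h := YoungDiagram.ext h
  IsTab l T := (∀ i j₁ j₂, j₁ < j₂ → (i, j₂) ∈ l → T i j₁ ≤ T i j₂) ∧
    (∀ i₁ i₂ j, i₁ < i₂ → (i₂, j) ∈ l → T i₁ j < T i₂ j) ∧ ∀ i j, (i, j) ∉ l → T i j = 0
  Strip _ l m := HorizontalStrip l m
  zeros h := h.2.2
  cells_subset h := by
    rintro ⟨i, j⟩ hc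
    exact YoungDiagram.rowLen_le_rowLen_iff.1 (h i).1 j hc
  restrict {a l T} h hb := by
    obtain ⟨hr, hc, hz⟩ := h
    have hmono : ∀ i i' j j', i ≤ i' → j ≤ j' → (i', j') ∈ l → T i j ≤ T i' j' := by
      intro i i' j j' hi hj hm
      have h1 : T i j ≤ T i j' := by
        rcases hj.eq_or_lt with rfl | hj
        · rfl
        · exact hr _ _ _ hj (l.up_left_mem hi le_rfl hm)
      have h2 : T i j' ≤ T i' j' := by
        rcases hi.eq_or_lt with rfl | hi
        · rfl
        · exact (hc _ _ _ hi hm).le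
      exact h1.trans h2
    let m : YoungDiagram :=
      { cells := l.cells.filter fun c => T c.1 c.2 < a
        isLowerSet := by
          rintro ⟨i', j'⟩ ⟨i, j⟩ ⟨hi, hj⟩ hm
          rw [coe_filter] at hm ⊢
          exact ⟨l.up_left_mem hi hj hm.1, (hmono _ _ _ _ hi hj hm.1).trans_lt hm.2⟩ }
    have hm : ∀ i j, (i, j) ∈ m ↔ (i, j) ∈ l ∧ T i j < a := fun i j => by
      rw [← YoungDiagram.mem_cells]
      exact mem_filter
    refine ⟨m, fun i => ⟨?_, ?_⟩, rfl, ?_, ?_, ?_⟩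
    · rw [YoungDiagram.rowLen_le_rowLen_iff]
      exact fun j hj => ((hm i j).1 hj).1
    · rw [YoungDiagram.rowLen_le_rowLen_iff]
      intro j hj
      have h1 := hc i (i + 1) j (Nat.lt_succ_self i) hj
      have h2 := hb _ hj
      simp only at h2
      exact (hm i j).2 ⟨l.up_left_mem (Nat.le_succ i) le_rfl hj, by omega⟩
    · intro i j₁ j₂ hj h2
      have h1 := m.up_left_mem (le_refl i) hj.le h2
      simp only [YoungDiagram.mem_cells, h1, h2, if_true]
      exact hr i j₁ j₂ hj ((hm _ _).1 h2).1
    · intro i₁ i₂ j hi h2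
      have h1 := m.up_left_mem hi.le (le_refl j) h2
      simp only [YoungDiagram.mem_cells, h1, h2, if_true]
      exact hc i₁ i₂ j hi ((hm _ _).1 h2).1
    · intro i j h1
      simp only [YoungDiagram.mem_cells, h1, if_false]
  extend {a l m T} h ht hb := by
    obtain ⟨hr, hc, hz⟩ := ht
    refine ⟨?_, ?_, ?_⟩
    · intro i j₁ j₂ hj h2
      have h1 := l.up_left_mem (le_refl i) hj.le h2
      simp only [YoungDiagram.mem_cells, h1, h2, if_true]
      split_ifs with h3 h4 h4
      · exact hr i j₁ j₂ hj h4
      · exact (hb _ h3).le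
      · exact absurd (m.up_left_mem (le_refl i) hj.le h4) h3
      · exact le_rfl
    · intro i₁ i₂ j hi h2
      have h1 := l.up_left_mem hi.le (le_refl j) h2
      have h5 : (i₁, j) ∈ m := YoungDiagram.rowLen_le_rowLen_iff.1 (h i₁).2 j
        (l.up_left_mem hi le_rfl h2)
      simp only [YoungDiagram.mem_cells, h5, h2, if_true]
      split_ifs with h4
      · exact hc i₁ i₂ j hi h4
      · exact hb _ h5
    · intro i j h1
      have h2 : (i, j) ∉ m := fun h2 => h1 (YoungDiagram.rowLen_le_rowLen_iff.1 (h i).1 j h2)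
      simp only [YoungDiagram.mem_cells, h1, h2, if_false]

/-- The coefficient of a monomial does not see letters whose variable is absent, so finitely many
letters suffice. -/
theorem coeff_schurS (K : Type*) [Field K] (l : Ptn) (e : ℕ →₀ ℕ) {a : ℕ}
    (ha : ∀ n, a ≤ n → e n = 0) :
    MvPowerSeries.coeff e (schurS K l) =
      MvPowerSeries.coeff e (ssytSystem.genSum MvPowerSeries.X a (diagram l)) := by
  rw [ssytSystem.coeff_genSum K (fun n => n) e ha]
  change ((Nat.card _ : ℕ) : K) = _
  congr 1
  refine Nat.card_congr
    { toFun := fun T => ⟨T.1, ⟨fun _ _ _ h => T.1.row_weak h, fun _ _ _ h => T.1.col_strict h,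
        fun _ _ h => T.1.zeros h⟩, T.2⟩
      invFun := fun T => ⟨⟨T.1, fun {_ _ _} h => T.2.1.1 _ _ _ h,
        fun {_ _ _} h => T.2.1.2.1 _ _ _ h, fun {_ _} h => T.2.1.2.2 _ _ h⟩, T.2.2⟩
      left_inv := fun _ => rfl
      right_inv := fun _ => rfl }

/-- The weight of a horizontal strip. -/
def stripWeight (R : Type*) [CommRing R] (l m : YoungDiagram) : R :=
  open Classical in if HorizontalStrip l m then 1 else 0

theorem genSum_ssytSystem {R : Type*} [CommRing R] (z : ℕ → R) (a : ℕ) :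
    ssytSystem.genSum z a = chainSum (stripWeight R) z a := by
  induction a with
  | zero =>
    funext l
    rw [chainSum, ssytSystem.genSum_zero YoungDiagram.deg_eq_zero]
    refine ⟨?_, ?_, ?_⟩ <;> simp
  | succ a ih =>
    funext l
    rw [ssytSystem.genSum_succ, ih]
    rfl

/-- The local bijection between the common upper and the common lower neighbours of two
partitions reflects the rows in the intervals in which they are free. -/
def reflectDown (m n l : YoungDiagram) : YoungDiagram :=
  youngOfRows (fun i => max (m.rowLen (i + 1)) (n.rowLen (i + 1)) +
    min (m.rowLen i) (n.rowLen i) - l.rowLen (i + 1)) (m.colLen 0 + n.colLen 0)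

/-- The inverse of `reflectDown`; the length of the first row is free. -/
def reflectUp (m n r : YoungDiagram) (j : ℕ) : YoungDiagram :=
  youngOfRows (fun i => match i with
    | 0 => max (m.rowLen 0) (n.rowLen 0) + j
    | i + 1 => max (m.rowLen (i + 1)) (n.rowLen (i + 1)) +
        min (m.rowLen i) (n.rowLen i) - r.rowLen i) (m.colLen 0 + n.colLen 0 + 1)

variable {m n l r : YoungDiagram}

theorem rowLen_reflectDown (hm : HorizontalStrip l m) (hn : HorizontalStrip l n) (i : ℕ) :
    (reflectDown m n l).rowLen i = max (m.rowLen (i + 1)) (n.rowLen (i + 1)) +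
      min (m.rowLen i) (n.rowLen i) - l.rowLen (i + 1) := by
  -- Row `i` of the reflected diagram lies between `max (m (i+1)) (n (i+1))` and `min (m i) (n i)`,
  -- and these intervals decrease with `i`.
  refine rowLen_youngOfRows (antitone_nat_of_succ_le fun i => ?_) ?_ i
  · have := hm i
    have := hn i
    have := hm (i + 1)
    have := hn (i + 1)
    have := hm (i + 1 + 1)
    have := hn (i + 1 + 1)
    omega
  · have := m.rowLen_colLen_zero (N := m.colLen 0 + n.colLen 0) (by omega)
    have := m.rowLen_colLen_zero (N := m.colLen 0 + n.colLen 0 + 1) (by omega)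
    have := n.rowLen_colLen_zero (N := m.colLen 0 + n.colLen 0 + 1) (by omega)
    omega

theorem rowLen_reflectUp_zero (hm : HorizontalStrip m r) (hn : HorizontalStrip n r) (j : ℕ) :
    (reflectUp m n r j).rowLen 0 = max (m.rowLen 0) (n.rowLen 0) + j ∧
    ∀ i, (reflectUp m n r j).rowLen (i + 1) = max (m.rowLen (i + 1)) (n.rowLen (i + 1)) +
      min (m.rowLen i) (n.rowLen i) - r.rowLen i := by
  have h := rowLen_youngOfRows (f := fun i => match i with
    | 0 => max (m.rowLen 0) (n.rowLen 0) + j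
    | i + 1 => max (m.rowLen (i + 1)) (n.rowLen (i + 1)) +
        min (m.rowLen i) (n.rowLen i) - r.rowLen i) (N := m.colLen 0 + n.colLen 0 + 1)
    (antitone_nat_of_succ_le fun i => ?_) ?_
  · exact ⟨h 0, fun i => h (i + 1)⟩
  · rcases i with _ | i
    · have := hm 0
      have := hn 0
      simp only
      omega
    · have := hm i
      have := hn i
      have := hm (i + 1)
      have := hn (i + 1)
      simp only
      omega
  · have := m.rowLen_colLen_zero (N := m.colLen 0 + n.colLen 0) (by omega)
    have := m.rowLen_colLen_zero (N := m.colLen 0 + n.colLen 0 + 1) (by omega)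
    have := n.rowLen_colLen_zero (N := m.colLen 0 + n.colLen 0 + 1) (by omega)
    simp only
    omega

theorem strip_reflectDown (hm : HorizontalStrip l m) (hn : HorizontalStrip l n) :
    HorizontalStrip m (reflectDown m n l) ∧ HorizontalStrip n (reflectDown m n l) := by
  refine ⟨fun i => ?_, fun i => ?_⟩ <;>
  · have := hm i
    have := hn i
    have := hm (i + 1)
    have := hn (i + 1)
    rw [rowLen_reflectDown hm hn]
    omega

theorem strip_reflectUp (hm : HorizontalStrip m r) (hn : HorizontalStrip n r) (j : ℕ) :
    HorizontalStrip (reflectUp m n r j) m ∧ HorizontalStrip (reflectUp m n r j) n := by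
  obtain ⟨h0, h1⟩ := rowLen_reflectUp_zero hm hn j
  refine ⟨fun i => ?_, fun i => ?_⟩ <;>
  · have := hm i
    have := hn i
    rw [h1]
    rcases i with _ | i
    · omega
    · have := hm i
      have := hn i
      rw [h1]
      omega

theorem reflectUp_reflectDown (hm : HorizontalStrip l m) (hn : HorizontalStrip l n) :
    reflectUp m n (reflectDown m n l) (l.rowLen 0 - max (m.rowLen 0) (n.rowLen 0)) = l := by
  obtain ⟨h2, h3⟩ := strip_reflectDown hm hn
  obtain ⟨h0, h1⟩ := rowLen_reflectUp_zero h2 h3 (l.rowLen 0 - max (m.rowLen 0) (n.rowLen 0))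
  refine YoungDiagram.ext_rowLen fun i => ?_
  rcases i with _ | i
  · have := hm 0
    have := hn 0
    omega
  · rw [h1, rowLen_reflectDown hm hn]
    have := hm i
    have := hn i
    have := hm (i + 1)
    have := hn (i + 1)
    omega

theorem reflectDown_reflectUp (hm : HorizontalStrip m r) (hn : HorizontalStrip n r) (j : ℕ) :
    reflectDown m n (reflectUp m n r j) = r := by
  obtain ⟨h2, h3⟩ := strip_reflectUp hm hn j
  obtain ⟨h0, h1⟩ := rowLen_reflectUp_zero hm hn j
  refine YoungDiagram.ext_rowLen fun i => ?_
  rw [rowLen_reflectDown h2 h3, h1]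
  have := hm i
  have := hn i
  omega

/-- Row `i + 1` of `l` and row `i` of its reflection add up to the sum of the endpoints of their
interval; summing with `max + min = m + n` leaves only the first row of `l` unmatched. -/
theorem card_reflectDown (hm : HorizontalStrip l m) (hn : HorizontalStrip l n) :
    l.card + (reflectDown m n l).card + max (m.rowLen 0) (n.rowLen 0) =
      m.card + n.card + l.rowLen 0 := by
  set N := m.colLen 0 + n.colLen 0 with hN
  have m0 := m.rowLen_colLen_zero (N := N) (by omega)
  have n0 := n.rowLen_colLen_zero (N := N) (by omega)
  have m1 := m.rowLen_colLen_zero (N := N + 1) (by omega)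
  have n1 := n.rowLen_colLen_zero (N := N + 1) (by omega)
  have l1 : l.rowLen (N + 1) = 0 := by have := hm N; omega
  have r0 : (reflectDown m n l).rowLen N = 0 := by
    have := (strip_reflectDown hm hn).1 N
    omega
  rw [l.card_eq_sum_rowLen l1, YoungDiagram.card_eq_sum_rowLen _ r0, m.card_eq_sum_rowLen m1,
    n.card_eq_sum_rowLen n1, ← sum_add_distrib, sum_range_succ', add_right_comm (∑ k ∈ _, _) _ _,
    ← sum_add_distrib]
  have e1 : ∀ i ∈ range N, l.rowLen (i + 1) + (reflectDown m n l).rowLen i =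
      max (m.rowLen (i + 1)) (n.rowLen (i + 1)) + min (m.rowLen i) (n.rowLen i) := by
    intro i _
    have := hm i
    have := hn i
    rw [rowLen_reflectDown hm hn]
    omega
  have e2 : ∀ i, m.rowLen i + n.rowLen i =
      max (m.rowLen i) (n.rowLen i) + min (m.rowLen i) (n.rowLen i) := by
    intro i; omega
  rw [sum_congr rfl e1, sum_congr rfl fun i _ => e2 i, sum_add_distrib, sum_add_distrib,
    sum_range_succ' (fun i => max (m.rowLen i) (n.rowLen i)),
    sum_range_succ (fun i => min (m.rowLen i) (n.rowLen i)), m0, n0]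
  simp only [min_self]
  omega

/-- Both sides count: common upper neighbours on the left, common lower neighbours together with a
free integer on the right. The integer is the excess of the first row, and each of its values has
weight 1, so the kernel is the geometric series. -/
theorem stripCommute_stripWeight (R : Type*) [CommRing R] :
    StripCommute (stripWeight R) (stripWeight R) (fun _ => 1) := by
  classical
  intro m n s
  have e : ∀ a b c d : YoungDiagram, stripWeight R a b * stripWeight R c d =
      if HorizontalStrip a b ∧ HorizontalStrip c d then 1 else 0 := by
    intro a b c d
    simp only [stripWeight]
    split_ifs <;> simp_all
  simp only [e, one_mul]
  simp only [← ite_and]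
  rw [sum_boole, ← sum_product', sum_sigma', sum_boole]
  congr 1
  refine card_bij' (fun l _ => ⟨((l.rowLen 0 - max (m.rowLen 0) (n.rowLen 0),
      s - (l.rowLen 0 - max (m.rowLen 0) (n.rowLen 0))),
      ((reflectDown m n l).card, n.card - (reflectDown m n l).card)), reflectDown m n l⟩)
    (fun p _ => reflectUp m n p.2 p.1.1.1) ?_ ?_ ?_ ?_
  · intro l hl
    rw [mem_filter, mem_level, YoungDiagram.deg_eq, YoungDiagram.deg_eq] at hl
    obtain ⟨hd, hm, hn⟩ := hl
    obtain ⟨h1, h2⟩ := strip_reflectDown hm hn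
    have h3 := card_reflectDown hm hn
    have h4 := card_le_card (ssytSystem.cells_subset (a := 0) h2)
    have h5 := card_le_card (ssytSystem.cells_subset (a := 0) h1)
    change (reflectDown m n l).card ≤ n.card at h4
    change (reflectDown m n l).card ≤ m.card at h5
    have := hm 0
    have := hn 0
    simp only [mem_filter, mem_sigma, mem_product, HasAntidiagonal.mem_antidiagonal, mem_level,
      YoungDiagram.deg_eq]
    refine ⟨⟨⟨?_, ?_⟩, trivial⟩, ?_, h2, h1⟩ <;> omega
  · intro p hp
    simp only [mem_filter, mem_sigma, mem_product, HasAntidiagonal.mem_antidiagonal, mem_level,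
      YoungDiagram.deg_eq] at hp
    obtain ⟨⟨⟨p1, p2⟩, p3⟩, p4, hn, hm⟩ := hp
    obtain ⟨h1, h2⟩ := strip_reflectUp hm hn p.1.1.1
    have h3 := card_reflectDown h1 h2
    rw [reflectDown_reflectUp hm hn, (rowLen_reflectUp_zero hm hn _).1] at h3
    rw [mem_filter, mem_level, YoungDiagram.deg_eq, YoungDiagram.deg_eq]
    exact ⟨by omega, h1, h2⟩
  · intro l hl
    rw [mem_filter] at hl
    exact reflectUp_reflectDown hl.2.1 hl.2.2
  · rintro ⟨⟨⟨p1, p2⟩, q1, q2⟩, r⟩ hp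
    simp only [mem_filter, mem_sigma, mem_product, HasAntidiagonal.mem_antidiagonal, mem_level,
      YoungDiagram.deg_eq] at hp
    obtain ⟨⟨⟨rfl, hq⟩, rfl⟩, p4, hn, hm⟩ := hp
    have h0 := (rowLen_reflectUp_zero hm hn p1).1
    simp only [reflectDown_reflectUp hm hn, h0, ← hq, Nat.add_sub_cancel_left]

end Young

/-! ### Shifted diagrams encoded by the lengths of their diagonals -/

section Shifted

/-- The number of elements of `A` that are at least `c`. If `A` consists of the parts of a strict
partition, each diminished by one, this is the number of cells on the `c`-th diagonal of the shifted
diagram. -/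
def above (A : Finset ℕ) (c : ℕ) : ℕ := #{a ∈ A | c ≤ a}

/-- The profile `above A` drops by one exactly at the elements of `A`. It therefore determines `A`,
and containment and strip conditions become inequalities between profiles. -/
theorem above_eq_add (A : Finset ℕ) (c : ℕ) :
    above A c = above A (c + 1) + if c ∈ A then 1 else 0 := by
  have h : ({a ∈ A | c ≤ a} : Finset ℕ) = {a ∈ A | c + 1 ≤ a} ∪ {a ∈ A | a = c} := by
    ext a
    simp only [mem_filter, mem_union, ← and_or_left]
    exact and_congr_right fun _ => by omega
  rw [above, h, card_union_of_disjoint, above, filter_eq']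
  · split_ifs <;> simp
  · rw [disjoint_filter]
    intro a _ h1 h2
    omega

theorem above_zero (A : Finset ℕ) : above A 0 = #A := by simp [above]

theorem above_succ_le (A : Finset ℕ) (c : ℕ) : above A (c + 1) ≤ above A c := by
  rw [above_eq_add A c]; omega

theorem above_le_succ (A : Finset ℕ) (c : ℕ) : above A c ≤ above A (c + 1) + 1 := by
  rw [above_eq_add A c]; split_ifs <;> omega

theorem above_antitone (A : Finset ℕ) : Antitone (above A) := antitone_nat_of_succ_le (above_succ_le A)

theorem above_le_add (A : Finset ℕ) (c d : ℕ) : above A c ≤ above A (c + d) + d := by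
  induction d with
  | zero => simp
  | succ d ih =>
    have := above_le_succ A (c + d)
    have h : above A (c + (d + 1)) = above A (c + d + 1) := rfl
    omega

theorem above_eq_zero {A : Finset ℕ} {N c : ℕ} (hA : A ⊆ range N) (hc : N ≤ c) :
    above A c = 0 := by
  rw [above, card_eq_zero, filter_eq_empty_iff]
  intro a ha
  have := mem_range.1 (hA ha)
  omega

theorem above_injective : Function.Injective above := by
  intro A B h
  ext c
  have h1 := above_eq_add A c
  have h2 := above_eq_add B c
  rw [h] at h1
  split_ifs at h1 h2 <;> simp_all

theorem subset_range_sup (A : Finset ℕ) : A ⊆ range (A.sup (· + 1)) := fun _ ha =>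
  mem_range.2 (Finset.le_sup (f := (· + 1)) ha)

/-- The finite set with prescribed numbers of large elements. -/
def ofAbove (k : ℕ → ℕ) (N : ℕ) : Finset ℕ := {c ∈ range N | k c ≠ k (c + 1)}

/-- The steps of size one of `k` are the elements of the set; downward induction starts from `N`,
beyond which both profiles vanish. -/
theorem above_ofAbove {k : ℕ → ℕ} {N : ℕ} (h : ∀ c, k (c + 1) ≤ k c ∧ k c ≤ k (c + 1) + 1)
    (hN : ∀ c, N ≤ c → k c = 0) : above (ofAbove k N) = k := by
  have key : ∀ d c, N ≤ c + d → above (ofAbove k N) c = k c := by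
    intro d
    induction d with
    | zero =>
      intro c hc
      rw [hN c hc]
      exact above_eq_zero (N := N) (filter_subset _ _) (by omega)
    | succ d ih =>
      intro c hc
      rw [above_eq_add, ih (c + 1) (by omega), ofAbove]
      simp only [mem_filter, mem_range]
      have h1 := h c
      have h2 := hN c
      have h3 := hN (c + 1)
      split_ifs <;> omega
  funext c
  exact key N c (by omega)

/-- The cells of a shifted diagram. -/
def shiftedDiagram (A : Finset ℕ) : Finset (ℕ × ℕ) :=
  (range (A.sup (· + 1))).biUnion fun c => (range (above A c)).image fun i => (i, i + c)

theorem mem_shiftedDiagram_add {A : Finset ℕ} {i c : ℕ} :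
    (i, i + c) ∈ shiftedDiagram A ↔ i < above A c := by
  simp only [shiftedDiagram, mem_biUnion, mem_image, mem_range, Prod.mk.injEq]
  constructor
  · rintro ⟨c', -, i', hi', rfl, h⟩
    obtain rfl : c' = c := by omega
    exact hi'
  · intro h
    refine ⟨c, ?_, i, h, rfl, rfl⟩
    by_contra hc
    rw [above_eq_zero (subset_range_sup A) (not_lt.1 hc)] at h
    omega

theorem mem_shiftedDiagram {A : Finset ℕ} {i j : ℕ} :
    (i, j) ∈ shiftedDiagram A ↔ i ≤ j ∧ i < above A (j - i) := by
  constructor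
  · intro h
    have hij : i ≤ j := by
      simp only [shiftedDiagram, mem_biUnion, mem_image, mem_range, Prod.mk.injEq] at h
      omega
    obtain ⟨c, rfl⟩ := Nat.exists_eq_add_of_le hij
    rw [mem_shiftedDiagram_add] at h
    simpa using h
  · rintro ⟨hij, h⟩
    obtain ⟨c, rfl⟩ := Nat.exists_eq_add_of_le hij
    rw [mem_shiftedDiagram_add]
    simpa using h

/-- Passing to a diagonal closer to the main one does not shorten it. Passing `d` diagonals outwards
shortens it by at most `d`, but then the row index has decreased by at least `d`. -/
theorem shiftedDiagram_lower {A : Finset ℕ} {i j i' j' : ℕ} (h : (i', j') ∈ shiftedDiagram A)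
    (hi : i ≤ i') (hj : j ≤ j') (hij : i ≤ j) : (i, j) ∈ shiftedDiagram A := by
  rw [mem_shiftedDiagram] at h ⊢
  refine ⟨hij, ?_⟩
  rcases le_total (j - i) (j' - i') with h1 | h1
  · have := above_antitone A h1
    omega
  · obtain ⟨d, hd⟩ := Nat.exists_eq_add_of_le h1
    have := above_le_add A (j' - i') d
    rw [hd]
    omega

theorem card_shiftedDiagram (A : Finset ℕ) {N : ℕ} (hA : A ⊆ range N) :
    #(shiftedDiagram A) = ∑ c ∈ range N, above A c := by
  rw [shiftedDiagram, card_biUnion]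
  · have h1 : A.sup (· + 1) ≤ N := Finset.sup_le fun a ha => mem_range.1 (hA ha)
    rw [← sum_subset (range_subset_range.2 h1)]
    · refine sum_congr rfl fun c _ => ?_
      rw [card_image_of_injective _ (fun a b h => (Prod.mk.inj h).1), card_range]
    · intro c _ hc
      exact above_eq_zero (subset_range_sup A) (not_lt.1 fun h => hc (mem_range.2 h))
  · intro c _ c' _ hne
    rw [Function.onFun, disjoint_left]
    rintro p hp hp'
    obtain ⟨i, -, rfl⟩ := mem_image.1 hp
    obtain ⟨i', -, h⟩ := mem_image.1 hp'
    rw [Prod.mk.injEq] at h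
    omega

/-- The part `a + 1` puts a cell on each of the diagonals `0, …, a`. Hence a bound on the degree
bounds the elements, and each degree has finitely many shapes. -/
theorem lt_card_shiftedDiagram {A : Finset ℕ} {a : ℕ} (ha : a ∈ A) : a < #(shiftedDiagram A) := by
  rw [card_shiftedDiagram A (subset_range_sup A)]
  have h1 : ∀ c ∈ range (a + 1), 1 ≤ above A c := fun c hc =>
    card_pos.2 ⟨a, mem_filter.2 ⟨ha, Nat.lt_succ_iff.1 (mem_range.1 hc)⟩⟩
  have h2 : range (a + 1) ⊆ range (A.sup (· + 1)) :=
    range_subset_range.2 (mem_range.1 (subset_range_sup A ha))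
  calc a < ∑ c ∈ range (a + 1), 1 := by simp
    _ ≤ ∑ c ∈ range (a + 1), above A c := sum_le_sum h1
    _ ≤ _ := sum_le_sum_of_subset h2

instance : GradedFinite (Finset ℕ) where
  deg A := #(shiftedDiagram A)
  finite_deg n := by
    refine ((range n).powerset.finite_toSet).subset ?_
    rintro A rfl
    rw [mem_coe, mem_powerset]
    exact fun a ha => mem_range.2 (lt_card_shiftedDiagram ha)

theorem deg_eq_card_shiftedDiagram (A : Finset ℕ) : GradedFinite.deg A = #(shiftedDiagram A) := rfl

theorem deg_finset_eq_zero (A : Finset ℕ) : GradedFinite.deg A = 0 ↔ A = ∅ := by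
  constructor
  · intro h
    rw [eq_empty_iff_forall_notMem]
    intro a ha
    have := lt_card_shiftedDiagram ha
    rw [deg_eq_card_shiftedDiagram] at h
    omega
  · rintro rfl
    rw [deg_eq_card_shiftedDiagram, card_shiftedDiagram ∅ (empty_subset (range 0)), range_zero,
      sum_empty]

/-- The skew shifted diagram `A / B` has at most one cell in each row. -/
def VertStrip (A B : Finset ℕ) : Prop := ∀ c, above B c ≤ above A c ∧ above A (c + 1) ≤ above B c

/-- The skew shifted diagram `A / B` has at most one cell in each column. -/
def HorStrip (A B : Finset ℕ) : Prop :=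
  ∀ c, above B c ≤ above A c ∧ above A c ≤ above B (c + 1) + 1

theorem shiftedDiagram_subset {A B : Finset ℕ} (h : ∀ c, above B c ≤ above A c) :
    shiftedDiagram B ⊆ shiftedDiagram A := by
  rintro ⟨i, j⟩ hc
  rw [mem_shiftedDiagram] at hc ⊢
  exact ⟨hc.1, hc.2.trans_le (h _)⟩

theorem exists_lt_iff_of_lower (n : ℕ) (p : ℕ → Prop) (hp : ∀ i, i + 1 < n → p (i + 1) → p i) :
    ∃ k, ∀ i, i < k ↔ i < n ∧ p i := by
  classical
  have hex : ∃ k, ¬ (k < n ∧ p k) := ⟨n, fun h => lt_irrefl _ h.1⟩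
  refine ⟨Nat.find hex, fun i => ⟨fun h => not_not.1 (Nat.find_min hex h), fun h => ?_⟩⟩
  by_contra hi
  have key : ∀ d, Nat.find hex + d < n → p (Nat.find hex + d) → p (Nat.find hex) := by
    intro d
    induction d with
    | zero => exact fun _ h => h
    | succ d ih => exact fun h1 h2 => ih (by omega) (hp _ (by omega) h2)
  obtain ⟨d, hd⟩ := Nat.exists_eq_add_of_le (not_lt.1 hi)
  rw [hd] at h
  exact Nat.find_spec hex ⟨by omega, key d h.1 h.2⟩

/-- Marked shifted tableaux, built up letter by letter. -/
def mstSystem : TableauSystem (Finset ℕ) where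
  cells := shiftedDiagram
  card_cells _ := rfl
  cells_injective A B h := above_injective <| funext fun c => eq_of_forall_lt_iff fun i => by
    rw [← mem_shiftedDiagram_add, h, mem_shiftedDiagram_add]
  IsTab l T :=
    (∀ i j₁ j₂, j₁ < j₂ → (i, j₁) ∈ shiftedDiagram l → (i, j₂) ∈ shiftedDiagram l →
      T i j₁ ≤ T i j₂) ∧
    (∀ i₁ i₂ j, i₁ < i₂ → (i₁, j) ∈ shiftedDiagram l → (i₂, j) ∈ shiftedDiagram l →
      T i₁ j ≤ T i₂ j) ∧
    (∀ i j₁ j₂, j₁ < j₂ → (i, j₁) ∈ shiftedDiagram l → (i, j₂) ∈ shiftedDiagram l →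
      Even (T i j₁) → T i j₁ ≠ T i j₂) ∧
    (∀ i₁ i₂ j, i₁ < i₂ → (i₁, j) ∈ shiftedDiagram l → (i₂, j) ∈ shiftedDiagram l →
      Odd (T i₁ j) → T i₁ j ≠ T i₂ j) ∧
    ∀ i j, (i, j) ∉ shiftedDiagram l → T i j = 0
  Strip a l m := (Even a → VertStrip l m) ∧ (Odd a → HorStrip l m)
  zeros h := h.2.2.2.2
  cells_subset {a l m} h := by
    refine shiftedDiagram_subset fun c => ?_
    rcases Nat.even_or_odd a with ha | ha
    · exact (h.1 ha c).1
    · exact (h.2 ha c).1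
  restrict {a l T} h hb := by
    obtain ⟨hr, hc, hrm, hcu, hz⟩ := h
    have hdown : ∀ c i, i + 1 < above l c → T (i + 1) (i + 1 + c) < a → T i (i + c) < a := by
      intro c i hi ht
      have h1 := mem_shiftedDiagram_add.2 hi
      have h2 : (i, i + 1 + c) ∈ shiftedDiagram l :=
        shiftedDiagram_lower h1 (Nat.le_succ i) le_rfl (by omega)
      have h3 : (i, i + c) ∈ shiftedDiagram l :=
        shiftedDiagram_lower h1 (Nat.le_succ i) (by omega) (by omega)
      exact ((hr i _ _ (by omega) h3 h2).trans (hc _ _ _ (Nat.lt_add_one i) h2 h1)).trans_lt ht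
    -- Letters weakly increase along each diagonal, so the cells with letters below `a` form an
    -- initial segment of it, of length `k c`. The next two inequalities make `k` the profile of a
    -- strict partition.
    choose k hk using fun c => exists_lt_iff_of_lower (above l c) (fun i => T i (i + c) < a)
      (hdown c)
    have hk1 : ∀ c, k (c + 1) ≤ k c := fun c => le_of_forall_lt fun i hi => by
      rw [hk] at hi ⊢
      have h1 := hi.1.trans_le (above_succ_le l c)
      exact ⟨h1, (hr i _ _ (by omega) (mem_shiftedDiagram_add.2 h1)
        (mem_shiftedDiagram_add.2 hi.1)).trans_lt hi.2⟩
    have hk2 : ∀ c, k c ≤ k (c + 1) + 1 := fun c => le_of_forall_lt fun i hi => by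
      rcases i with _ | i
      · omega
      · rw [hk] at hi
        refine Nat.succ_lt_succ ((hk (c + 1) i).2 ?_)
        have h1 := mem_shiftedDiagram_add.2 hi.1
        have h2 : (i, i + (c + 1)) ∈ shiftedDiagram l :=
          shiftedDiagram_lower h1 (Nat.le_succ i) (by omega) (by omega)
        refine ⟨mem_shiftedDiagram_add.1 h2, ?_⟩
        have h3 : i + (c + 1) = i + 1 + c := by omega
        rw [h3] at h2 ⊢
        exact (hc _ _ _ (Nat.lt_add_one i) h2 h1).trans_lt hi.2
    have hle : ∀ c, k c ≤ above l c := fun c => le_of_forall_lt fun i hi => ((hk c i).1 hi).1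
    obtain ⟨m, hm⟩ : ∃ m, above m = k := ⟨_, above_ofAbove (N := l.sup (· + 1))
      (fun c => ⟨hk1 c, hk2 c⟩) fun c hc => Nat.le_zero.1
        ((hle c).trans (above_eq_zero (subset_range_sup l) hc).le)⟩
    have hmem : ∀ i j, (i, j) ∈ shiftedDiagram m ↔ (i, j) ∈ shiftedDiagram l ∧ T i j < a := by
      intro i j
      rw [mem_shiftedDiagram, mem_shiftedDiagram, hm, hk, and_assoc]
      refine and_congr_right fun hij => ?_
      rw [Nat.add_sub_cancel' hij]
    -- Two equal marked letters in a row, or two equal unmarked letters in a column, would be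
    -- neighbouring cells with letter `a`; excluding them gives the strip inequality for each
    -- parity.
    refine ⟨m, ⟨fun ha c => ⟨hm ▸ hle c, ?_⟩, fun ha c => ⟨hm ▸ hle c, ?_⟩⟩, ?_, ?_⟩
    · rw [hm]
      refine le_of_forall_lt fun i hi => ?_
      have h1 := mem_shiftedDiagram_add.2 hi
      have h2 := mem_shiftedDiagram_add.2 (hi.trans_le (above_succ_le l c))
      refine (hk c i).2 ⟨mem_shiftedDiagram_add.1 h2, ?_⟩
      have h3 := hr i _ _ (by omega) h2 h1
      have h4 := hb _ h1
      simp only at h4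
      by_contra h5
      have h6 : T i (i + c) = a := by omega
      exact hrm i _ _ (by omega) h2 h1 (h6 ▸ ha) (by omega)
    · rw [hm]
      refine le_of_forall_lt fun i hi => ?_
      rcases i with _ | i
      · omega
      · refine Nat.succ_lt_succ ((hk (c + 1) i).2 ?_)
        have h1 := mem_shiftedDiagram_add.2 hi
        have h2 : (i, i + (c + 1)) ∈ shiftedDiagram l :=
          shiftedDiagram_lower h1 (Nat.le_succ i) (by omega) (by omega)
        refine ⟨mem_shiftedDiagram_add.1 h2, ?_⟩
        have h3 : i + (c + 1) = i + 1 + c := by omega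
        rw [h3] at h2 ⊢
        have h4 := hc _ _ _ (Nat.lt_add_one i) h2 h1
        have h5 := hb _ h1
        simp only at h5
        by_contra h6
        have h7 : T i (i + 1 + c) = a := by omega
        exact hcu _ _ _ (Nat.lt_add_one i) h2 h1 (h7 ▸ ha) (by omega)
    · ext ⟨i, j⟩
      rw [hmem, mem_filter]
    · refine ⟨?_, ?_, ?_, ?_, ?_⟩
      · intro i j₁ j₂ hj h1 h2
        simp only [h1, h2, if_true]
        exact hr _ _ _ hj ((hmem _ _).1 h1).1 ((hmem _ _).1 h2).1
      · intro i₁ i₂ j hi h1 h2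
        simp only [h1, h2, if_true]
        exact hc _ _ _ hi ((hmem _ _).1 h1).1 ((hmem _ _).1 h2).1
      · intro i j₁ j₂ hj h1 h2
        simp only [h1, h2, if_true]
        exact hrm _ _ _ hj ((hmem _ _).1 h1).1 ((hmem _ _).1 h2).1
      · intro i₁ i₂ j hi h1 h2
        simp only [h1, h2, if_true]
        exact hcu _ _ _ hi ((hmem _ _).1 h1).1 ((hmem _ _).1 h2).1
      · intro i j h1
        simp only [h1, if_false]
  extend {a l m T} h ht hb := by
    obtain ⟨hr, hc, hrm, hcu, hz⟩ := ht
    have hsub : shiftedDiagram m ⊆ shiftedDiagram l := by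
      refine shiftedDiagram_subset fun c => ?_
      rcases Nat.even_or_odd a with ha | ha
      · exact (h.1 ha c).1
      · exact (h.2 ha c).1
    have hij : ∀ {i j}, (i, j) ∈ shiftedDiagram l → i ≤ j := fun h => (mem_shiftedDiagram.1 h).1
    refine ⟨?_, ?_, ?_, ?_, ?_⟩
    · intro i j₁ j₂ hj h1 h2
      simp only [h1, h2, if_true]
      split_ifs with h3 h4 h4
      · exact hr _ _ _ hj h3 h4
      · exact (hb _ h3).le
      · exact absurd (shiftedDiagram_lower h4 le_rfl hj.le (hij h1)) h3
      · exact le_rfl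
    · intro i₁ i₂ j hi h1 h2
      simp only [h1, h2, if_true]
      split_ifs with h3 h4 h4
      · exact hc _ _ _ hi h3 h4
      · exact (hb _ h3).le
      · exact absurd (shiftedDiagram_lower h4 hi.le le_rfl (hij h1)) h3
      · exact le_rfl
    · intro i j₁ j₂ hj h1 h2
      simp only [h1, h2, if_true]
      split_ifs with h3 h4 h4
      · exact hrm _ _ _ hj h3 h4
      · exact fun _ => (hb _ h3).ne
      · exact absurd (shiftedDiagram_lower h4 le_rfl hj.le (hij h1)) h3
      · intro ha
        exfalso
        apply h3
        obtain ⟨c, rfl⟩ := Nat.exists_eq_add_of_le (hij h1)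
        rw [mem_shiftedDiagram_add]
        have h5 : (i, i + (c + 1)) ∈ shiftedDiagram l :=
          shiftedDiagram_lower h2 le_rfl (by omega) (by omega)
        exact (mem_shiftedDiagram_add.1 h5).trans_le (h.1 ha c).2
    · intro i₁ i₂ j hi h1 h2
      simp only [h1, h2, if_true]
      split_ifs with h3 h4 h4
      · exact hcu _ _ _ hi h3 h4
      · exact fun _ => (hb _ h3).ne
      · exact absurd (shiftedDiagram_lower h4 hi.le le_rfl (hij h1)) h3
      · intro ha
        exfalso
        apply h3
        have h5 : (i₁ + 1, j) ∈ shiftedDiagram l :=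
          shiftedDiagram_lower h2 hi le_rfl (by have := hij h2; omega)
        obtain ⟨c, rfl⟩ := Nat.exists_eq_add_of_le (hij h5)
        have h6 := (mem_shiftedDiagram_add.1 h5).trans_le (h.2 ha c).2
        have h7 : i₁ + 1 + c = i₁ + (c + 1) := by omega
        rw [h7, mem_shiftedDiagram_add]
        omega
    · intro i j h1
      have h2 : (i, j) ∉ shiftedDiagram m := fun h2 => h1 (hsub h2)
      simp only [h1, h2, if_false]

end Shifted

/-! ### Merging the marked and unmarked strips of one letter -/

section ShiftedWeights

/-- The parts of two strict partitions interlace. -/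
def Interlace (A B : Finset ℕ) : Prop := ∀ c, above B c ≤ above A c ∧ above A c ≤ above B c + 1

/-- The diagonals on which the letter of a skew tableau with letters `0'` and `0` is free. -/
def freeDiagonals (A B : Finset ℕ) : Finset ℕ :=
  (B \ A).image (· + 1) ∪ if #B < #A then {0} else ∅

theorem succ_mem_freeDiagonals {A B : Finset ℕ} {c : ℕ} :
    c + 1 ∈ freeDiagonals A B ↔ c ∈ B ∧ c ∉ A := by
  rw [freeDiagonals, mem_union, mem_image]
  constructor
  · rintro (⟨c', h, h'⟩ | h)
    · obtain rfl : c' = c := by omega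
      exact mem_sdiff.1 h
    · split_ifs at h <;> simp at h
  · intro h
    exact Or.inl ⟨c, mem_sdiff.2 h, rfl⟩

theorem zero_mem_freeDiagonals {A B : Finset ℕ} : 0 ∈ freeDiagonals A B ↔ #B < #A := by
  rw [freeDiagonals, mem_union, mem_image]
  constructor
  · rintro (⟨c', h, h'⟩ | h)
    · omega
    · split_ifs at h with h1
      · exact h1
      · simp at h
  · intro h
    right
    simp [h]

/-- The skew shape has at most one cell per diagonal and splits into runs of consecutive diagonals.
Free diagonals are the lower ends of the runs, elements of `A \ B` their upper ends. The diagonal 0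
makes up for the difference `#A - #B`, which is 0 or 1. -/
theorem card_freeDiagonals {A B : Finset ℕ} (h : Interlace A B) :
    #(freeDiagonals A B) = #(A \ B) := by
  have h0 := h 0
  rw [above_zero, above_zero] at h0
  have h1 := card_sdiff_add_card A B
  have h2 := card_sdiff_add_card B A
  rw [union_comm] at h2
  rw [freeDiagonals, card_union_of_disjoint, card_image_of_injective _ (add_left_injective 1)]
  · split_ifs with h3
    · rw [card_singleton]; omega
    · rw [card_empty]; omega
  · rw [disjoint_left]
    intro c hc hc'
    obtain ⟨c', -, rfl⟩ := mem_image.1 hc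
    split_ifs at hc' <;> simp at hc'

/-- The diagonal lengths of the shape between `B` and `A` determined by the free diagonals on which
a cell is added. -/
def midAbove (A B M : Finset ℕ) (c : ℕ) : ℕ :=
  if c ∈ M then above B c + 1 else
    match c with
    | 0 => above B 0
    | c + 1 => max (above B (c + 1)) (above A c - 1)

/-- These are the inequalities for a vertical strip over `B` and a horizontal strip up to `A`. On a
free diagonal both choices fit between the bounds; elsewhere the smallest admissible value is taken.
-/
theorem midAbove_spec {A B M : Finset ℕ} (h : Interlace A B) (hM : M ⊆ freeDiagonals A B) (c : ℕ) :
    (above B c ≤ midAbove A B M c ∧ midAbove A B M c ≤ above A c) ∧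
    above A c ≤ midAbove A B M (c + 1) + 1 ∧ midAbove A B M (c + 1) ≤ above B c := by
  have h1 := h c
  have h2 := h (c + 1)
  have a1 := above_eq_add A c
  have b1 := above_eq_add B c
  have hm1 : c + 1 ∈ M → c ∈ B ∧ c ∉ A := fun hm => succ_mem_freeDiagonals.1 (hM hm)
  constructor
  · rcases c with _ | c
    · have hm0 : 0 ∈ M → above B 0 < above A 0 := fun hm => by
        rw [above_zero, above_zero]
        exact zero_mem_freeDiagonals.1 (hM hm)
      simp only [midAbove]
      split_ifs with hm
      · have := hm0 hm
        omega
      · omega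
    · have h0 := h c
      have a0 := above_eq_add A c
      have b0 := above_eq_add B c
      have hm0 : c + 1 ∈ M → c ∈ B ∧ c ∉ A := fun hm => succ_mem_freeDiagonals.1 (hM hm)
      simp only [midAbove]
      split_ifs with hm
      · obtain ⟨h3, h4⟩ := hm0 hm
        rw [if_neg h4] at a0
        rw [if_pos h3] at b0
        omega
      · have : above A c ≤ above A (c + 1) + 1 := above_le_succ A c
        omega
  · simp only [midAbove]
    split_ifs with hm
    · obtain ⟨h3, h4⟩ := hm1 hm
      rw [if_neg h4] at a1
      rw [if_pos h3] at b1
      omega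
    · have : above B (c + 1) ≤ above B c := above_succ_le B c
      omega

theorem exists_above_eq_midAbove {A B M : Finset ℕ} (h : Interlace A B)
    (hM : M ⊆ freeDiagonals A B) : ∃ C, above C = midAbove A B M := by
  refine ⟨_, above_ofAbove (N := A.sup (· + 1)) (fun c => ?_) fun c hc => ?_⟩
  · have := midAbove_spec h hM c
    omega
  · have := midAbove_spec h hM c
    have := above_eq_zero (subset_range_sup A) hc
    omega

/-- On a diagonal that is not free, the upper and lower bounds for `above C` coincide, so an
intermediate shape is determined by its free diagonals. -/
theorem midAbove_filter {A B C : Finset ℕ} (hA : HorStrip A C) (hB : VertStrip C B) :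
    midAbove A B {c ∈ freeDiagonals A B | above B c < above C c} = above C := by
  funext c
  have hc1 := hB c
  rcases c with _ | c
  · have h0 := hA 0
    have h1 := hA 1
    have h2 := hB 1
    have a1 := above_succ_le A 0
    have a2 := above_le_succ C 0
    have a3 := above_le_succ A 0
    simp only [midAbove, mem_filter, zero_mem_freeDiagonals, ← above_zero]
    split_ifs with h <;> omega
  · have h0 := hA c
    have h1 := hB c
    have h2 := hA (c + 1)
    have a0 := above_eq_add A c
    have b0 := above_eq_add B c
    simp only [midAbove, mem_filter, succ_mem_freeDiagonals]
    split_ifs at a0 b0 ⊢ <;> simp_all <;> omega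

theorem filter_midAbove {A B M : Finset ℕ} (hM : M ⊆ freeDiagonals A B)
    (h : Interlace A B) : {c ∈ freeDiagonals A B | above B c < midAbove A B M c} = M := by
  ext c
  rw [mem_filter]
  constructor
  · rintro ⟨h1, h2⟩
    by_contra h3
    rcases c with _ | c
    · simp only [midAbove, h3, if_false] at h2
      omega
    · simp only [midAbove, h3, if_false] at h2
      obtain ⟨h4, h5⟩ := succ_mem_freeDiagonals.1 h1
      have h6 := h c
      have h7 := h (c + 1)
      have a0 := above_eq_add A c
      have b0 := above_eq_add B c
      rw [if_neg h5] at a0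
      rw [if_pos h4] at b0
      omega
  · intro h1
    refine ⟨hM h1, ?_⟩
    simp only [midAbove, h1, if_true]
    omega

/-- The number of skew tableaux with letters `0'` and `0`. -/
theorem sum_between (R : Type*) [CommRing R] (A B : Finset ℕ) :
    open Classical in
    ∑ i ∈ range (GradedFinite.deg A + 1), ∑ C ∈ level (Finset ℕ) i,
      (if HorStrip A C then (1 : R) else 0) * (if VertStrip C B then 1 else 0) =
      if Interlace A B then 2 ^ #(A \ B) else 0 := by
  classical
  have e : ∀ C : Finset ℕ, (if HorStrip A C then (1 : R) else 0) *
      (if VertStrip C B then 1 else 0) = if HorStrip A C ∧ VertStrip C B then 1 else 0 := by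
    intro C
    split_ifs <;> simp_all
  simp only [e]
  rw [sum_sigma', sum_boole]
  split_ifs with h
  · rw [← card_freeDiagonals h]
    suffices hs : #{p ∈ (range (GradedFinite.deg A + 1)).sigma (fun i => level (Finset ℕ) i) |
        HorStrip A p.2 ∧ VertStrip p.2 B} = #(freeDiagonals A B).powerset by
      rw [hs, card_powerset, Nat.cast_pow, Nat.cast_ofNat]
    -- An intermediate shape corresponds to the set of free diagonals whose cell carries the marked
    -- letter.
    refine card_bij (fun p _ => {c ∈ freeDiagonals A B | above B c < above p.2 c}) ?_ ?_ ?_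
    · intro p _
      exact mem_powerset.2 (filter_subset _ _)
    · rintro ⟨i, C⟩ hp ⟨i', C'⟩ hp' heq
      simp only [mem_filter, mem_sigma, mem_level] at hp hp'
      have : C = C' := above_injective <| by
        rw [← midAbove_filter hp.2.1 hp.2.2, ← midAbove_filter hp'.2.1 hp'.2.2, heq]
      subst this
      rw [← hp.1.2, ← hp'.1.2]
    · intro M hM
      rw [mem_powerset] at hM
      obtain ⟨C, hC⟩ := exists_above_eq_midAbove h hM
      have hs := fun c => midAbove_spec h hM c
      have h1 : HorStrip A C := fun c => by rw [hC]; exact ⟨(hs c).1.2, (hs c).2.1⟩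
      have h2 : VertStrip C B := fun c => by rw [hC]; exact ⟨(hs c).1.1, (hs c).2.2⟩
      refine ⟨⟨GradedFinite.deg C, C⟩, ?_, ?_⟩
      · simp only [mem_filter, mem_sigma, mem_level, mem_range, and_true]
        refine ⟨Nat.lt_succ_iff.2 ?_, h1, h2⟩
        exact card_le_card (shiftedDiagram_subset fun c => (h1 c).1)
      · simp only [hC]
        exact filter_midAbove hM h
  · rw [filter_false_of_mem, card_empty, Nat.cast_zero]
    rintro ⟨i, C⟩ - ⟨h1, h2⟩
    refine h fun c => ?_
    have h3 := h1 c
    have h4 := h2 c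
    have := (h2 (c + 1)).1
    constructor <;> omega

/-- Consecutive strips with the same variable merge because their sizes add. The hypothesis `hB`
makes the truncated subtractions of degrees exact. It is needed since `k'` and `k` share one
variable. -/
theorem raise_raise {P R : Type*} [GradedFinite P] [CommRing R] {A B : P → P → R}
    (hB : ∀ l m, B l m ≠ 0 → GradedFinite.deg m ≤ GradedFinite.deg l) (x : R) (F : P → R) (l : P) :
    raise A x (raise B x F) l =
      raise (fun l m => ∑ i ∈ range (GradedFinite.deg l + 1), ∑ c ∈ level P i, A l c * B c m)
        x F l := by
  simp only [raise]
  rw [Nat.sum_antidiagonal_eq_sum_range_succ_mk, Nat.sum_antidiagonal_eq_sum_range_succ_mk]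
  have e1 : ∀ i ∈ range (GradedFinite.deg l + 1), ∀ c ∈ level P i,
      x ^ (GradedFinite.deg l - i) * (A l c * ∑ p ∈ antidiagonal (GradedFinite.deg c), x ^ p.2 *
        ∑ m ∈ level P p.1, B c m * F m) =
      ∑ k ∈ range (GradedFinite.deg l + 1), x ^ (GradedFinite.deg l - k) *
        ∑ m ∈ level P k, A l c * B c m * F m := by
    intro i hi c hc
    rw [mem_level] at hc
    rw [mem_range] at hi
    rw [Nat.sum_antidiagonal_eq_sum_range_succ_mk, mul_sum, mul_sum,
      ← sum_subset (range_subset_range.2 (show GradedFinite.deg c + 1 ≤ GradedFinite.deg l + 1 by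
        omega))]
    · refine sum_congr rfl fun k hk => ?_
      rw [mem_range] at hk
      have : GradedFinite.deg l - k = (GradedFinite.deg l - i) + (GradedFinite.deg c - k) := by
        omega
      rw [this, pow_add, mul_sum, mul_sum, mul_sum, mul_sum]
      refine sum_congr rfl fun m _ => by ring
    · intro k _ hk
      rw [mem_range] at hk
      rw [sum_eq_zero, mul_zero]
      intro m hm
      rw [mem_level] at hm
      have : B c m = 0 := by
        by_contra h
        have := hB c m h
        omega
      rw [this, mul_zero, zero_mul]
  have e2 : ∀ i ∈ range (GradedFinite.deg l + 1),
      x ^ (GradedFinite.deg l - i) * ∑ c ∈ level P i, A l c *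
        ∑ p ∈ antidiagonal (GradedFinite.deg c), x ^ p.2 * ∑ m ∈ level P p.1, B c m * F m =
      ∑ k ∈ range (GradedFinite.deg l + 1), ∑ c ∈ level P i, x ^ (GradedFinite.deg l - k) *
        ∑ m ∈ level P k, A l c * B c m * F m := by
    intro i hi
    rw [mul_sum, sum_congr rfl (e1 i hi), sum_comm]
  rw [sum_congr rfl e2, sum_comm]
  refine sum_congr rfl fun k _ => ?_
  simp only [sum_mul, mul_sum]
  rw [sum_congr rfl fun i _ => sum_comm, sum_comm]

end ShiftedWeights

/-! ### Six-vertex model and Yang–Baxter relation -/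

section Transfer

variable {R : Type*} [CommRing R]

/-- The local weight of a column of the six-vertex model whose rows describe interlacing strict
partitions: `a` and `b` are the occupations of the upper and the lower partition and `h` is the state
of the edge on the right. -/
def vertexWeight (α β x : R) (a b h : Bool) : R :=
  if a = b then (if h then x else 1)
  else if a then (if h then 0 else α * x) else (if h then β else 0)

/-- The weight of the first `N` columns of a row with state `h` on the right. -/
def rowWeight (α β x : R) (A B : Finset ℕ) : ℕ → Bool → R
  | 0, _ => 1
  | N + 1, h => vertexWeight α β x (N ∈ A) (N ∈ B) h *
      rowWeight α β x A B N (xor h (xor (N ∈ A) (N ∈ B)))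

theorem rowWeight_congr (α β x : R) {A A' B B' : Finset ℕ} {N : ℕ}
    (hA : ∀ c < N, c ∈ A ↔ c ∈ A') (hB : ∀ c < N, c ∈ B ↔ c ∈ B') (h : Bool) :
    rowWeight α β x A B N h = rowWeight α β x A' B' N h := by
  induction N generalizing h with
  | zero => rfl
  | succ N ih =>
    simp only [rowWeight]
    rw [ih (fun c hc => hA c (by omega)) fun c hc => hB c (by omega)]
    simp only [hA N (Nat.lt_succ_self N), hB N (Nat.lt_succ_self N)]

/-- The partition function of two rows with a common upper partition. -/
def sumUp (x y : R) (B C : Finset ℕ) (N : ℕ) (h k : Bool) : R :=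
  ∑ A ∈ (range N).powerset, rowWeight 2 1 x A B N h * rowWeight 1 2 y A C N k

/-- The partition function of two rows with a common lower partition. -/
def sumDown (x y : R) (B C : Finset ℕ) (N : ℕ) (h k : Bool) : R :=
  ∑ D ∈ (range N).powerset, rowWeight 2 1 x C D N h * rowWeight 1 2 y B D N k

/-- One transfer step: the last column of the summed partition is empty or occupied, and the two
right-edge states are updated by comparison with `B` and `C`. -/
theorem sumUp_succ (x y : R) (B C : Finset ℕ) (N : ℕ) (h k : Bool) :
    sumUp x y B C (N + 1) h k =
      vertexWeight 2 1 x false (N ∈ B) h * vertexWeight 1 2 y false (N ∈ C) k *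
        sumUp x y B C N (xor h (N ∈ B)) (xor k (N ∈ C)) +
      vertexWeight 2 1 x true (N ∈ B) h * vertexWeight 1 2 y true (N ∈ C) k *
        sumUp x y B C N (xor h (!(N ∈ B))) (xor k (!(N ∈ C))) := by
  rw [sumUp, range_add_one, sum_powerset_insert notMem_range_self]
  congr 1
  · rw [sumUp, mul_sum]
    refine sum_congr rfl fun A hA => ?_
    have hN : N ∉ A := fun h => notMem_range_self (mem_powerset.1 hA h)
    simp only [rowWeight, hN, decide_false, Bool.false_xor]
    ring
  · rw [sumUp, mul_sum]
    refine sum_congr rfl fun A hA => ?_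
    have hN : ∀ c < N, c ∈ insert N A ↔ c ∈ A := fun c hc => by
      rw [mem_insert, or_iff_right (by omega)]
    simp only [rowWeight, mem_insert_self, decide_true, Bool.true_xor]
    rw [rowWeight_congr 2 1 x hN fun c _ => Iff.rfl, rowWeight_congr 1 2 y hN fun c _ => Iff.rfl]
    ring

theorem sumDown_succ (x y : R) (B C : Finset ℕ) (N : ℕ) (h k : Bool) :
    sumDown x y B C (N + 1) h k =
      vertexWeight 2 1 x (N ∈ C) false h * vertexWeight 1 2 y (N ∈ B) false k *
        sumDown x y B C N (xor h (N ∈ C)) (xor k (N ∈ B)) +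
      vertexWeight 2 1 x (N ∈ C) true h * vertexWeight 1 2 y (N ∈ B) true k *
        sumDown x y B C N (xor h (!(N ∈ C))) (xor k (!(N ∈ B))) := by
  rw [sumDown, range_add_one, sum_powerset_insert notMem_range_self]
  congr 1
  · rw [sumDown, mul_sum]
    refine sum_congr rfl fun A hA => ?_
    have hN : N ∉ A := fun h => notMem_range_self (mem_powerset.1 hA h)
    simp only [rowWeight, hN, decide_false, Bool.xor_false]
    ring
  · rw [sumDown, mul_sum]
    refine sum_congr rfl fun A hA => ?_
    have hN : ∀ c < N, c ∈ insert N A ↔ c ∈ A := fun c hc => by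
      rw [mem_insert, or_iff_right (by omega)]
    simp only [rowWeight, mem_insert_self, decide_true, Bool.xor_true]
    rw [rowWeight_congr 2 1 x (fun c _ => Iff.rfl) hN, rowWeight_congr 1 2 y (fun c _ => Iff.rfl) hN]
    ring

/-- The Yang–Baxter relation for two rows. -/
theorem sumDown_sumUp_yangBaxter (x y : R) (B C : Finset ℕ) (N : ℕ) :
    sumDown x y B C N false false + x * y * sumDown x y B C N true true =
      sumUp x y B C N false false + x * y * sumUp x y B C N true true ∧
    sumDown x y B C N false false - sumDown x y B C N true true =
      sumUp x y B C N true true - sumUp x y B C N false false ∧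
    sumDown x y B C N true false = sumUp x y B C N true false ∧
    sumDown x y B C N false true = sumUp x y B C N false true := by
  induction N with
  | zero =>
    simp only [sumUp, sumDown, range_zero, powerset_empty, sum_singleton, rowWeight]
    refine ⟨trivial, by simp, trivial, trivial⟩
  | succ N ih =>
    obtain ⟨h1, h2, h3, h4⟩ := ih
    simp only [sumUp_succ, sumDown_succ]
    -- The four relations are stable under adding a column for every occupation of `B` and `C`. They
    -- hold at `N = 0` because the left boundary is free, all partition functions being 1.
    cases decide (N ∈ B) <;> cases decide (N ∈ C) <;>
      simp only [vertexWeight, h3, h4, Bool.xor_true, Bool.xor_false, Bool.not_true, Bool.not_false,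
        Bool.false_eq_true, Bool.true_eq_false, if_true, if_false]
    · refine ⟨?_, ?_, ?_, ?_⟩
      · linear_combination (1 + x * y) * h1 + x * y * h2
      · linear_combination -h1
      · ring
      · ring
    · refine ⟨?_, ?_, ?_, ?_⟩
      · ring
      · ring
      · ring
      · linear_combination 2 * h1
    · refine ⟨?_, ?_, ?_, ?_⟩
      · ring
      · ring
      · linear_combination h1
      · ring
    · refine ⟨?_, ?_, ?_, ?_⟩
      · linear_combination (1 + x * y) * h1 - x * y * h2
      · linear_combination h1
      · ring
      · ring

/-- Eliminates the lower sum with edge states `true` from the first two Yang–Baxter relations. Up to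
the last term this is the commutation relation with kernel `(1 + xy)/(1 - xy)`. -/
theorem one_add_mul_sumDown (x y : R) (B C : Finset ℕ) (N : ℕ) :
    (1 + x * y) * sumDown x y B C N false false =
      (1 - x * y) * sumUp x y B C N false false + 2 * (x * y) * sumUp x y B C N true true := by
  obtain ⟨h1, h2, -, -⟩ := sumDown_sumUp_yangBaxter x y B C N
  linear_combination h1 + x * y * h2

/-- To the right of `B` and `C`, the edge state `true` prevents the upper partition from being
occupied, so each extra column contributes exactly `xy`. Hence this boundary term is divisible by
arbitrarily high powers. -/
theorem sumUp_add (x y : R) {B C : Finset ℕ} {N : ℕ} (hB : B ⊆ range N) (hC : C ⊆ range N)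
    (M : ℕ) : sumUp x y B C (N + M) true true = (x * y) ^ M * sumUp x y B C N true true := by
  induction M with
  | zero => simp
  | succ M ih =>
    have h1 : N + M ∉ B := fun h => by have := mem_range.1 (hB h); omega
    have h2 : N + M ∉ C := fun h => by have := mem_range.1 (hC h); omega
    rw [← add_assoc, sumUp_succ]
    simp only [h1, h2, decide_false, Bool.xor_false]
    rw [ih]
    simp [vertexWeight]
    ring

end Transfer

/-! ### From row weights to weights of interlacing partitions -/

section ShiftedCommutation

theorem above_insert {A : Finset ℕ} {N : ℕ} (hA : A ⊆ range N) (c : ℕ) :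
    above (insert N A) c = above A c + if c ≤ N then 1 else 0 := by
  rw [above, filter_insert]
  split_ifs with h
  · rw [card_insert_of_notMem, above]
    intro hN
    have := mem_range.1 (hA (mem_filter.1 hN).1)
    omega
  · rw [above, add_zero]

theorem sum_above_succ {A : Finset ℕ} {N : ℕ} (hA : A ⊆ range N) :
    ∑ c ∈ range (N + 1), above A c = ∑ c ∈ range N, above A c := by
  rw [sum_range_succ, above_eq_zero hA le_rfl, add_zero]

theorem sum_above_insert {A : Finset ℕ} {N : ℕ} (hA : A ⊆ range N) :
    ∑ c ∈ range (N + 1), above (insert N A) c = ∑ c ∈ range N, above A c + (N + 1) := by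
  have : ∀ c ∈ range (N + 1), above (insert N A) c = above A c + 1 := fun c hc => by
    rw [above_insert hA, if_pos (Nat.lt_succ_iff.1 (mem_range.1 hc))]
  rw [sum_congr rfl this, sum_add_distrib, sum_above_succ hA]
  simp

theorem eq_insert_or_subset_range {A : Finset ℕ} {N : ℕ} (hA : A ⊆ range (N + 1)) :
    A ⊆ range N ∨ ∃ A' ⊆ range N, A = insert N A' := by
  by_cases h : N ∈ A
  · refine Or.inr ⟨A.erase N, fun a ha => ?_, (insert_erase h).symm⟩
    rw [mem_erase] at ha
    have := mem_range.1 (hA ha.2)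
    rw [mem_range]
    omega
  · refine Or.inl fun a ha => ?_
    have := mem_range.1 (hA ha)
    have h1 : a ≠ N := fun h1 => h (h1 ▸ ha)
    rw [mem_range]
    omega

/-- Interlacing of two strict partitions, the upper one having `h` additional large parts. -/
def InterlaceAdd (A B : Finset ℕ) (h : ℕ) : Prop :=
  ∀ c, above B c ≤ above A c + h ∧ above A c + h ≤ above B c + 1

theorem interlaceAdd_insert_insert {A B : Finset ℕ} {N : ℕ} (hA : A ⊆ range N) (hB : B ⊆ range N)
    (h : ℕ) : InterlaceAdd (insert N A) (insert N B) h ↔ InterlaceAdd A B h := by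
  refine forall_congr' fun c => ?_
  rw [above_insert hA, above_insert hB]
  split_ifs <;> omega

theorem interlaceAdd_insert_left {A B : Finset ℕ} {N : ℕ} (hA : A ⊆ range N) (hB : B ⊆ range N) :
    InterlaceAdd (insert N A) B 0 ↔ InterlaceAdd A B 1 := by
  refine forall_congr' fun c => ?_
  rw [above_insert hA]
  have h1 := above_eq_zero (c := c) hA
  have h2 := above_eq_zero (c := c) hB
  split_ifs <;> omega

theorem interlaceAdd_insert_right {A B : Finset ℕ} {N : ℕ} (hA : A ⊆ range N) (hB : B ⊆ range N) :
    InterlaceAdd A (insert N B) 1 ↔ InterlaceAdd A B 0 := by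
  refine forall_congr' fun c => ?_
  rw [above_insert hB]
  have h1 := above_eq_zero (c := c) hA
  have h2 := above_eq_zero (c := c) hB
  split_ifs <;> omega

theorem not_interlaceAdd_insert_left {A B : Finset ℕ} {N : ℕ} (hA : A ⊆ range N)
    (hB : B ⊆ range N) : ¬ InterlaceAdd (insert N A) B 1 := fun h => by
  have := h N
  rw [above_insert hA, above_eq_zero hA le_rfl, above_eq_zero hB le_rfl] at this
  simp at this

theorem not_interlaceAdd_insert_right {A B : Finset ℕ} {N : ℕ} (hA : A ⊆ range N)
    (hB : B ⊆ range N) : ¬ InterlaceAdd A (insert N B) 0 := fun h => by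
  have := h N
  rw [above_insert hB, above_eq_zero hA le_rfl, above_eq_zero hB le_rfl] at this
  simp at this

-- The edge state is the difference of the two profiles, so each diagonal carrying a cell
-- contributes `x`, while `α` and `β` mark the columns where only one partition is occupied. State
-- `true` on the right stands for an additional large upper part, which adds a cell on each of the
-- `N` diagonals. The factor in `B` avoids subtraction of exponents.
open Classical in
theorem rowWeight_mul_pow {R : Type*} [CommRing R] (α β x : R) {A B : Finset ℕ} {N : ℕ}
    (hA : A ⊆ range N) (hB : B ⊆ range N) (h : Bool) :
    rowWeight α β x A B N h * x ^ (∑ c ∈ range N, above B c) =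
      if InterlaceAdd A B h.toNat then
        α ^ #(A \ B) * β ^ #(B \ A) * x ^ (h.toNat * N + ∑ c ∈ range N, above A c) else 0 := by
  induction N generalizing A B h with
  | zero =>
    rw [range_zero, subset_empty] at hA hB
    subst hA hB
    rw [if_pos]
    · simp [rowWeight]
    · intro c
      cases h <;> simp
  | succ N ih =>
    have hi : ∀ A' ⊆ range N, ∀ c < N, c ∈ insert N A' ↔ c ∈ A' := fun A' _ c hc => by
      rw [mem_insert, or_iff_right (by omega)]
    have hn : ∀ A' ⊆ range N, N ∉ A' := fun A' hA' h => notMem_range_self (hA' h)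
    rcases eq_insert_or_subset_range hA with hA' | ⟨A', hA', rfl⟩ <;>
      rcases eq_insert_or_subset_range hB with hB' | ⟨B', hB', rfl⟩
    · simp only [rowWeight, hn _ hA', hn _ hB', decide_false, Bool.xor_false]
      rw [sum_above_succ hA', sum_above_succ hB', mul_assoc, ih hA' hB']
      split_ifs with hv
      · cases h <;> simp [vertexWeight, pow_add, pow_succ] ; ring
      · simp
    · simp only [rowWeight, hn _ hA', mem_insert_self, decide_false, decide_true, Bool.false_xor]
      rw [sum_above_succ hA', sum_above_insert hB',
        rowWeight_congr α β x (fun _ _ => Iff.rfl) (hi B' hB')]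
      cases h
      · rw [Bool.toNat_false, if_neg (not_interlaceAdd_insert_right hA' hB')]
        simp [vertexWeight]
      · have := ih hA' hB' false
        simp only [Bool.toNat_true, Bool.toNat_false, interlaceAdd_insert_right hA' hB'] at this ⊢
        rw [sdiff_insert_of_notMem (hn _ hA'), insert_sdiff_of_notMem _ (hn _ hA'),
          card_insert_of_notMem fun h => hn _ hB' (mem_sdiff.1 h).1]
        simp only [vertexWeight, Bool.xor_true, Bool.not_true, Bool.false_eq_true, if_false, if_true]
        rw [pow_add, mul_assoc, ← mul_assoc (rowWeight _ _ _ _ _ _ _), this]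
        split_ifs with hv
        · simp [pow_add, pow_succ]; ring
        · simp
    · simp only [rowWeight, hn _ hB', mem_insert_self, decide_false, decide_true, Bool.xor_false]
      rw [sum_above_succ hB', sum_above_insert hA',
        rowWeight_congr α β x (hi A' hA') (fun _ _ => Iff.rfl)]
      cases h
      · have := ih hA' hB' true
        simp only [Bool.toNat_true, Bool.toNat_false, interlaceAdd_insert_left hA' hB'] at this ⊢
        rw [sdiff_insert_of_notMem (hn _ hB'), insert_sdiff_of_notMem _ (hn _ hB'),
          card_insert_of_notMem fun h => hn _ hA' (mem_sdiff.1 h).1]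
        simp only [vertexWeight, Bool.xor_true, Bool.not_false, Bool.true_eq_false,
          Bool.false_eq_true, if_false, if_true]
        rw [mul_assoc, this]
        split_ifs with hv
        · simp [pow_add, pow_succ]; ring
        · simp
      · rw [Bool.toNat_true, if_neg (not_interlaceAdd_insert_left hA' hB')]
        simp [vertexWeight]
    · simp only [rowWeight, mem_insert_self, decide_true, Bool.xor_self, Bool.xor_false]
      rw [sum_above_insert hA', sum_above_insert hB',
        rowWeight_congr α β x (hi A' hA') (hi B' hB'), pow_add, mul_assoc,
        ← mul_assoc (rowWeight _ _ _ _ _ _ _), ih hA' hB']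
      simp only [interlaceAdd_insert_insert hA' hB']
      rw [insert_sdiff_insert, insert_sdiff_insert, sdiff_insert_of_notMem (hn _ hA'),
        sdiff_insert_of_notMem (hn _ hB')]
      split_ifs with hv
      · cases h <;> simp [vertexWeight, pow_add, pow_succ] <;> ring
      · simp

/-- The number of skew marked shifted tableaux of shape `A / B` with letters `0'` and `0`. -/
def qWeight (R : Type*) [CommRing R] (A B : Finset ℕ) : R :=
  open Classical in if Interlace A B then 2 ^ #(A \ B) else 0

/-- The coefficient of the skew `P`-function of shape `A / B` in one variable. -/
def pWeight (R : Type*) [CommRing R] (A B : Finset ℕ) : R :=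
  open Classical in if Interlace A B then 2 ^ #(B \ A) else 0

/-- The coefficients of `(1 + t) / (1 - t)`. -/
def qKernel (R : Type*) [CommRing R] (n : ℕ) : R := if n = 0 then 1 else 2

theorem one_sub_X_mul_mk_qKernel (R : Type*) [CommRing R] :
    (1 - PowerSeries.X) * PowerSeries.mk (qKernel R) = 1 + PowerSeries.X := by
  ext n
  rw [sub_mul, one_mul, map_sub, map_add, PowerSeries.coeff_one, PowerSeries.coeff_X]
  rcases n with _ | n
  · simp [qKernel]
  · rw [PowerSeries.coeff_succ_X_mul]
    rcases n with _ | n <;> simp [qKernel]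
    norm_num

theorem Interlace.deg_le {A B : Finset ℕ} (h : Interlace A B) :
    GradedFinite.deg B ≤ GradedFinite.deg A :=
  card_le_card (shiftedDiagram_subset fun c => (h c).1)

open Classical in
theorem rowWeight_X {A B : Finset ℕ} {N : ℕ} (hA : A ⊆ range N) (hB : B ⊆ range N) :
    rowWeight 2 1 PowerSeries.X A B N false = PowerSeries.C (qWeight ℤ A B) *
      PowerSeries.X ^ (GradedFinite.deg A - GradedFinite.deg B) := by
  have h := rowWeight_mul_pow 2 1 (PowerSeries.X : PowerSeries ℤ) hA hB false
  rw [← card_shiftedDiagram B hB, ← card_shiftedDiagram A hA] at h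
  -- Cancelling this power is possible in the domain `ℤ⟦X⟧`; other rings are reached later by base
  -- change.
  have hX : (PowerSeries.X : PowerSeries ℤ) ^ #(shiftedDiagram B) ≠ 0 :=
    pow_ne_zero _ PowerSeries.X_ne_zero
  refine mul_right_cancel₀ hX (h.trans ?_)
  have hI : InterlaceAdd A B false.toNat ↔ Interlace A B := Iff.rfl
  simp only [hI, qWeight]
  split_ifs with hv
  · rw [mul_assoc (PowerSeries.C _), ← pow_add, ← deg_eq_card_shiftedDiagram B,
      Nat.sub_add_cancel hv.deg_le]
    simp [deg_eq_card_shiftedDiagram]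
  · simp

open Classical in
theorem rowWeight_one {A B : Finset ℕ} {N : ℕ} (hA : A ⊆ range N) (hB : B ⊆ range N) :
    rowWeight 1 2 (1 : PowerSeries ℤ) A B N false = PowerSeries.C (pWeight ℤ A B) := by
  have h := rowWeight_mul_pow 1 2 (1 : PowerSeries ℤ) hA hB false
  rw [one_pow, mul_one] at h
  rw [h]
  have hI : InterlaceAdd A B false.toNat ↔ Interlace A B := Iff.rfl
  simp only [hI, pWeight]
  split_ifs with hv <;> simp

theorem sum_level_eq {f : Finset ℕ → ℤ} {n N : ℕ} (h : n ≤ N) :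
    ∑ A ∈ level (Finset ℕ) n, f A =
      ∑ A ∈ (range N).powerset, if GradedFinite.deg A = n then f A else 0 := by
  rw [← sum_filter]
  refine sum_congr ?_ fun _ _ => rfl
  ext A
  rw [mem_level, mem_filter, mem_powerset]
  refine ⟨fun hA => ⟨fun a ha => mem_range.2 ?_, hA⟩, fun hA => hA.2⟩
  have := lt_card_shiftedDiagram ha
  rw [deg_eq_card_shiftedDiagram] at hA
  omega

/-- Specialisation `x = X`, `y = 1` loses nothing, as one exponent and the degrees of `B` and `C`
determine the other. Dividing the Yang–Baxter consequence by `1 - X` gives the kernel, and the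
boundary term carries the factor `X ^ M`. -/
theorem mk_qKernel_mul_sumDown {B C : Finset ℕ} {N : ℕ} (hB : B ⊆ range N) (hC : C ⊆ range N)
    (M : ℕ) : PowerSeries.mk (qKernel ℤ) * sumDown PowerSeries.X 1 B C (N + M) false false =
      sumUp PowerSeries.X 1 B C (N + M) false false + PowerSeries.X ^ M *
        (2 * PowerSeries.X * PowerSeries.mk 1 * sumUp PowerSeries.X 1 B C N true true) := by
  have h1 := one_add_mul_sumDown (PowerSeries.X : PowerSeries ℤ) 1 B C (N + M)
  rw [sumUp_add _ _ hB hC, mul_one] at h1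
  have h2 := one_sub_X_mul_mk_qKernel ℤ
  have h3 := PowerSeries.mk_one_mul_one_sub_eq_one ℤ
  linear_combination (PowerSeries.mk 1) * h1 + PowerSeries.mk 1 *
    sumDown PowerSeries.X 1 B C (N + M) false false * h2 -
    (PowerSeries.mk (qKernel ℤ) * sumDown PowerSeries.X 1 B C (N + M) false false
      - sumUp PowerSeries.X 1 B C (N + M) false false) * h3

end ShiftedCommutation

/-! ### Commutation relation and tableau expansion for `Q` and `P` -/

section ShiftedCauchy

theorem qWeight_ne_zero {R : Type*} [CommRing R] {A B : Finset ℕ} (h : qWeight R A B ≠ 0) :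
    Interlace A B := by
  by_contra h1
  simp [qWeight, h1] at h

theorem pWeight_ne_zero {R : Type*} [CommRing R] {A B : Finset ℕ} (h : pWeight R A B ≠ 0) :
    Interlace A B := by
  by_contra h1
  simp [pWeight, h1] at h

/-- The factor `X ^ deg B` turns the exponent `deg A - deg B` into `deg A`, so a coefficient selects
one level. -/
theorem coeff_sumUp {B C : Finset ℕ} {N : ℕ} (hB : B ⊆ range N) (hC : C ⊆ range N) (n : ℕ) :
    PowerSeries.coeff n (PowerSeries.X ^ GradedFinite.deg B *
      sumUp PowerSeries.X (1 : PowerSeries ℤ) B C N false false) =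
    ∑ A ∈ (range N).powerset,
      if GradedFinite.deg A = n then qWeight ℤ A B * pWeight ℤ A C else 0 := by
  rw [sumUp, mul_sum, map_sum]
  refine sum_congr rfl fun A hA => ?_
  rw [mem_powerset] at hA
  rw [rowWeight_X hA hB, rowWeight_one hA hC]
  by_cases h : qWeight ℤ A B = 0
  · simp [h]
  · have h1 := (qWeight_ne_zero h).deg_le
    have h2 : (PowerSeries.X : PowerSeries ℤ) ^ GradedFinite.deg B *
        (PowerSeries.C (qWeight ℤ A B) *
          PowerSeries.X ^ (GradedFinite.deg A - GradedFinite.deg B) *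
          PowerSeries.C (pWeight ℤ A C)) =
        PowerSeries.C (qWeight ℤ A B * pWeight ℤ A C) * PowerSeries.X ^ GradedFinite.deg A := by
      rw [← Nat.sub_add_cancel h1, pow_add, Nat.add_sub_cancel, map_mul]
      ring
    rw [h2, PowerSeries.coeff_C_mul, PowerSeries.coeff_X_pow]
    simp only [eq_comm (a := n)]
    split_ifs <;> simp

theorem coeff_mk_mul_sumDown {B C : Finset ℕ} {N : ℕ} (hB : B ⊆ range N) (hC : C ⊆ range N)
    (k : ℕ → ℤ) (n : ℕ) :
    PowerSeries.coeff n (PowerSeries.X ^ GradedFinite.deg B * (PowerSeries.mk k *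
      sumDown PowerSeries.X (1 : PowerSeries ℤ) B C N false false)) =
    ∑ D ∈ (range N).powerset, qWeight ℤ C D * pWeight ℤ B D *
      if GradedFinite.deg B + (GradedFinite.deg C - GradedFinite.deg D) ≤ n then
        k (n - (GradedFinite.deg B + (GradedFinite.deg C - GradedFinite.deg D))) else 0 := by
  rw [sumDown, mul_sum, mul_sum, map_sum]
  refine sum_congr rfl fun D hD => ?_
  rw [mem_powerset] at hD
  rw [rowWeight_X hC hD, rowWeight_one hB hD]
  have h2 : (PowerSeries.X : PowerSeries ℤ) ^ GradedFinite.deg B * (PowerSeries.mk k *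
        (PowerSeries.C (qWeight ℤ C D) *
          PowerSeries.X ^ (GradedFinite.deg C - GradedFinite.deg D) *
          PowerSeries.C (pWeight ℤ B D))) =
        PowerSeries.C (qWeight ℤ C D * pWeight ℤ B D) *
        (PowerSeries.X ^ (GradedFinite.deg B + (GradedFinite.deg C - GradedFinite.deg D)) *
          PowerSeries.mk k) := by
    rw [pow_add, map_mul]
    ring
  rw [h2, PowerSeries.coeff_C_mul, PowerSeries.coeff_X_pow_mul']
  simp only [PowerSeries.coeff_mk]

theorem stripCommute_int : StripCommute (qWeight ℤ) (pWeight ℤ) (qKernel ℤ) := by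
  classical
  intro B C s
  obtain ⟨N, hB, hC⟩ : ∃ N, B ⊆ range N ∧ C ⊆ range N :=
    ⟨max (B.sup (· + 1)) (C.sup (· + 1)),
      (subset_range_sup B).trans (range_subset_range.2 (le_max_left _ _)),
      (subset_range_sup C).trans (range_subset_range.2 (le_max_right _ _))⟩
  set n := GradedFinite.deg C + s with hn
  have hB' : B ⊆ range (N + (n + 1)) := hB.trans (range_subset_range.2 (by omega))
  have hC' : C ⊆ range (N + (n + 1)) := hC.trans (range_subset_range.2 (by omega))
  -- With `n + 1` additional columns the boundary term is divisible by `X ^ (n + 1)` and does not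
  -- reach the coefficient of `X ^ n`.
  have h1 := congrArg (fun f => PowerSeries.coeff n (PowerSeries.X ^ GradedFinite.deg B * f))
    (mk_qKernel_mul_sumDown hB hC (n + 1))
  simp only [mul_add, map_add] at h1
  have h0 : ∀ E : PowerSeries ℤ, PowerSeries.coeff n
      (PowerSeries.X ^ GradedFinite.deg B * (PowerSeries.X ^ (n + 1) * E)) = 0 := fun E => by
    rw [← mul_assoc, ← pow_add, PowerSeries.coeff_X_pow_mul', if_neg (by omega)]
  rw [h0, add_zero, coeff_sumUp hB' hC', coeff_mk_mul_sumDown hB' hC'] at h1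
  rw [sum_level_eq (N := N + (n + 1)) (by omega), ← h1]
  have e1 : ∀ j : ℕ × ℕ, ∀ i ∈ antidiagonal (GradedFinite.deg C),
      (∑ r ∈ level (Finset ℕ) i.1,
        if i.1 + j.2 = GradedFinite.deg B then qWeight ℤ C r * pWeight ℤ B r else 0) =
      ∑ r ∈ (range (N + (n + 1))).powerset, if GradedFinite.deg r = i.1 then
        (if i.1 + j.2 = GradedFinite.deg B then qWeight ℤ C r * pWeight ℤ B r else 0) else 0 := by
    intro j i hi
    rw [HasAntidiagonal.mem_antidiagonal] at hi
    exact sum_level_eq (by omega)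
  have e3 : ∀ j ∈ antidiagonal s, qKernel ℤ j.1 * (∑ i ∈ antidiagonal (GradedFinite.deg C),
      ∑ r ∈ level (Finset ℕ) i.1,
        if i.1 + j.2 = GradedFinite.deg B then qWeight ℤ C r * pWeight ℤ B r else 0) =
      ∑ r ∈ (range (N + (n + 1))).powerset, qKernel ℤ j.1 *
        ∑ i ∈ antidiagonal (GradedFinite.deg C), if GradedFinite.deg r = i.1 then
          (if i.1 + j.2 = GradedFinite.deg B then qWeight ℤ C r * pWeight ℤ B r else 0)
            else 0 := fun j _ => by
    rw [sum_congr rfl (e1 j), sum_comm, mul_sum]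
  rw [sum_congr rfl e3, sum_comm]
  refine sum_congr rfl fun r _ => ?_
  by_cases hr : qWeight ℤ C r * pWeight ℤ B r = 0
  · simp [hr]
  have hCr := (qWeight_ne_zero (left_ne_zero_of_mul hr)).deg_le
  have hBr := (pWeight_ne_zero (right_ne_zero_of_mul hr)).deg_le
  have e2 : ∀ j ∈ antidiagonal s, qKernel ℤ j.1 * (∑ i ∈ antidiagonal (GradedFinite.deg C),
      if GradedFinite.deg r = i.1 then
        (if i.1 + j.2 = GradedFinite.deg B then qWeight ℤ C r * pWeight ℤ B r else 0) else 0) =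
      qKernel ℤ j.1 * if GradedFinite.deg r + j.2 = GradedFinite.deg B then
        qWeight ℤ C r * pWeight ℤ B r else 0 := by
    intro j _
    rw [sum_eq_single (GradedFinite.deg r, GradedFinite.deg C - GradedFinite.deg r)]
    · simp
    · rintro ⟨i, i'⟩ hi hne
      rw [HasAntidiagonal.mem_antidiagonal] at hi
      rw [if_neg]
      rintro rfl
      apply hne
      ext <;> simp only at hi ⊢
      omega
    · intro h
      exfalso
      apply h
      rw [HasAntidiagonal.mem_antidiagonal]
      simp only
      omega
  rw [sum_congr rfl e2]
  split_ifs with hs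
  · rw [sum_eq_single (s - (GradedFinite.deg B - GradedFinite.deg r),
      GradedFinite.deg B - GradedFinite.deg r)]
    · simp only
      rw [if_pos (by omega), mul_comm]
      congr 2
      omega
    · rintro ⟨j, j'⟩ hj hne
      rw [HasAntidiagonal.mem_antidiagonal] at hj
      rw [if_neg, mul_zero]
      intro h
      apply hne
      simp only at hj h
      ext <;> simp only <;> omega
    · intro h
      exfalso
      apply h
      rw [HasAntidiagonal.mem_antidiagonal]
      simp only
      omega
  · rw [mul_zero, sum_eq_zero]
    rintro ⟨j, j'⟩ hj
    rw [HasAntidiagonal.mem_antidiagonal] at hj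
    rw [if_neg, mul_zero]
    intro h
    simp only at hj h
    omega

theorem StripCommute.map {P R R' : Type*} [GradedFinite P] [CommRing R] [CommRing R']
    {A B : P → P → R} {k : ℕ → R} (h : StripCommute A B k) (f : R →+* R') :
    StripCommute (fun l m => f (A l m)) (fun l m => f (B l m)) (fun n => f (k n)) := by
  intro m n s
  have := congrArg f (h m n s)
  simpa only [map_sum, map_mul, apply_ite f, map_zero] using this

theorem stripCommute_qWeight (R : Type*) [CommRing R] :
    StripCommute (qWeight R) (pWeight R) (qKernel R) := by
  have h := stripCommute_int.map (Int.castRingHom R)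
  have e1 : (fun l m => Int.castRingHom R (qWeight ℤ l m)) = qWeight R := by
    funext l m
    simp [qWeight, apply_ite (Int.cast : ℤ → R)]
  have e2 : (fun l m => Int.castRingHom R (pWeight ℤ l m)) = pWeight R := by
    funext l m
    simp [pWeight, apply_ite (Int.cast : ℤ → R)]
  have e3 : (fun n => Int.castRingHom R (qKernel ℤ n)) = qKernel R := by
    funext n
    simp [qKernel, apply_ite (Int.cast : ℤ → R)]
  rwa [e1, e2, e3] at h

theorem interlace_self (A : Finset ℕ) : Interlace A A := fun _ => ⟨le_rfl, Nat.le_succ _⟩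

/-- The letters `2a` and `2a + 1` encode `a'` and `a`. Their vertical and horizontal strips are
merged by `raise_raise`, and `sum_between` evaluates the product as `qWeight`. -/
theorem genSum_mstSystem {R : Type*} [CommRing R] (z : ℕ → R) (a : ℕ) :
    mstSystem.genSum (fun n => z (n / 2)) (2 * a) = chainSum (qWeight R) z a := by
  classical
  induction a with
  | zero =>
    funext l
    rw [chainSum, mul_zero, mstSystem.genSum_zero deg_finset_eq_zero]
    refine ⟨?_, ?_, ?_, ?_, ?_⟩ <;> simp [mem_shiftedDiagram, above]
  | succ a ih =>
    funext l
    have h1 : mstSystem.genSum (fun n => z (n / 2)) (2 * a + 1) =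
        raise (fun l m => if VertStrip l m then 1 else 0) (z a) (chainSum (qWeight R) z a) := by
      funext l
      rw [mstSystem.genSum_succ, ih, Nat.mul_div_cancel_left _ two_pos]
      have : ∀ l m, mstSystem.Strip (2 * a) l m ↔ VertStrip l m := fun l m =>
        ⟨fun h => h.1 (even_two_mul a), fun h => ⟨fun _ => h, fun ho =>
          absurd (even_two_mul a) (Nat.not_even_iff_odd.2 ho)⟩⟩
      simp only [this]
    rw [mul_add, mul_one, mstSystem.genSum_succ, h1, chainSum]
    have h2 : ∀ l m, mstSystem.Strip (2 * a + 1) l m ↔ HorStrip l m := fun l m =>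
      ⟨fun h => h.2 (odd_two_mul_add_one a), fun h => ⟨fun he =>
        absurd (odd_two_mul_add_one a) (Nat.not_odd_iff_even.2 he), fun _ => h⟩⟩
    have h3 : (2 * a + 1) / 2 = a := by omega
    simp only [h2, h3]
    rw [raise_raise]
    · congr 1
      funext l m
      rw [qWeight, ← sum_between]
    · intro l m h
      by_cases hv : VertStrip l m
      · exact card_le_card (shiftedDiagram_subset fun c => (hv c).1)
      · simp [hv] at h

/-- For interlacing `l`, `m` one has `|l| + |m \ l| = |l ∪ m| = |m| + |l \ m|`, so the powers of 2
telescope along a chain down to the empty set. -/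
theorem chainSum_pWeight {R : Type*} [CommRing R] (x : ℕ → R) (n : ℕ) (l : Finset ℕ) :
    2 ^ #l * chainSum (pWeight R) x n l = chainSum (qWeight R) x n l := by
  induction n generalizing l with
  | zero =>
    simp only [chainSum]
    split_ifs with h
    · rw [(deg_finset_eq_zero l).1 h]; simp
    · simp
  | succ n ih =>
    simp only [chainSum, raise, mul_sum]
    refine sum_congr rfl fun p _ => sum_congr rfl fun m _ => ?_
    rw [← ih]
    have h : 2 ^ #l * pWeight R l m = qWeight R l m * 2 ^ #m := by
      rw [pWeight, qWeight]
      split_ifs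
      · rw [← pow_add, ← pow_add]
        congr 1
        have h1 := card_sdiff_add_card l m
        have h2 := card_sdiff_add_card m l
        rw [union_comm] at h2
        omega
      · simp
    linear_combination (x n ^ p.2 * chainSum (pWeight R) x n m) * h

/-- Conjugation of a partition: in a decreasing list the parts larger than `c` come first. This
translates row lengths into diagonal lengths. -/
theorem lt_getD_iff_lt_countP {L : List ℕ} (hL : L.Pairwise (· ≥ ·)) (i c : ℕ) :
    c < L.getD i 0 ↔ i < L.countP (fun p => c < p) := by
  induction L generalizing i with
  | nil => simp
  | cons a L ih =>
    rw [List.pairwise_cons] at hL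
    have ih' := fun i => ih hL.2 i
    by_cases h : c < a
    · rw [List.countP_cons_of_pos (by simpa using h)]
      rcases i with _ | i
      · simpa using h
      · rw [List.getD_cons_succ, ih']; omega
    · have h0 : (a :: L).countP (fun p => c < p) = 0 := by
        rw [List.countP_eq_zero]
        intro b hb
        rcases List.mem_cons.1 hb with rfl | hb
        · simpa using h
        · have := hL.1 b hb
          simp only [decide_eq_true_eq]
          omega
      have h1 : L.countP (fun p => c < p) = 0 := by
        rw [List.countP_cons] at h0; omega
      rw [h0]
      rcases i with _ | i
      · simp only [List.getD_cons_zero]; omega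
      · rw [List.getD_cons_succ, ih', h1]; omega

/-- A strict partition as a finite set: each part is diminished by one. -/
def predParts (l : StrictPtn) : Finset ℕ := l.1.2.parts.toFinset.image (· - 1)

theorem mem_predParts {l : StrictPtn} {a : ℕ} : a ∈ predParts l ↔ a + 1 ∈ l.1.2.parts := by
  rw [predParts, mem_image]
  constructor
  · rintro ⟨b, hb, rfl⟩
    rw [Multiset.mem_toFinset] at hb
    have := l.1.2.parts_pos hb
    rwa [Nat.sub_add_cancel this]
  · intro h
    exact ⟨a + 1, Multiset.mem_toFinset.2 h, rfl⟩

theorem above_predParts (l : StrictPtn) (c : ℕ) :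
    above (predParts l) c = (rows l.1).countP (fun p => c < p) := by
  rw [rows, ← Multiset.coe_countP, Multiset.sort_eq, Multiset.countP_eq_card_filter,
    ← Multiset.toFinset_card_of_nodup (l.2.filter _), above]
  refine card_bij (fun a _ => a + 1) ?_ (fun _ _ _ _ h => Nat.succ_injective h) ?_
  · intro a ha
    rw [mem_filter, mem_predParts] at ha
    rw [Multiset.mem_toFinset, Multiset.mem_filter]
    exact ⟨ha.1, by omega⟩
  · intro b hb
    rw [Multiset.mem_toFinset, Multiset.mem_filter] at hb
    have := l.1.2.parts_pos hb.1
    refine ⟨b - 1, ?_, Nat.sub_add_cancel this⟩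
    rw [mem_filter, mem_predParts, Nat.sub_add_cancel this]
    exact ⟨hb.1, by omega⟩

theorem card_predParts (l : StrictPtn) : #(predParts l) = len l.1 := by
  rw [predParts, card_image_of_injOn, Multiset.toFinset_card_of_nodup l.2, len]
  intro a ha b hb h
  rw [mem_coe, Multiset.mem_toFinset] at ha hb
  have := l.1.2.parts_pos ha
  have := l.1.2.parts_pos hb
  simp only at h
  omega

theorem shiftedCells_eq (l : StrictPtn) : shiftedCells l = shiftedDiagram (predParts l) := by
  ext ⟨i, j⟩
  rw [mem_shiftedDiagram, above_predParts, ← lt_getD_iff_lt_countP (rows_sortedGE l.1).pairwise]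
  simp only [shiftedCells, mem_biUnion, mem_range, mem_image, mem_Ico, Prod.mk.injEq]
  constructor
  · rintro ⟨i', -, j', h, rfl, rfl⟩
    omega
  · rintro ⟨h1, h2⟩
    refine ⟨i, ?_, j, by omega, rfl, rfl⟩
    by_contra h3
    rw [List.getD_eq_default _ _ (by
      rw [rows, Multiset.length_sort]; exact not_lt.1 h3)] at h2
    omega

theorem coeff_schurQ (K : Type*) [Field K] (l : StrictPtn) (e : ℕ →₀ ℕ) {a : ℕ}
    (ha : ∀ n, a ≤ n → e n = 0) :
    MvPowerSeries.coeff e (schurQ K l) =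
      MvPowerSeries.coeff e (chainSum (qWeight _) MvPowerSeries.X a (predParts l)) := by
  rw [← genSum_mstSystem, mstSystem.coeff_genSum K (fun n => n / 2) e fun n hn => ha _ (by omega)]
  change ((Nat.card _ : ℕ) : K) = _
  congr 1
  have hc := shiftedCells_eq l
  refine Nat.card_congr
    { toFun := fun T => ⟨T.1.entry, ⟨hc ▸ T.1.row_weak, hc ▸ T.1.col_weak, hc ▸ T.1.row_marked,
        hc ▸ T.1.col_unmarked, hc ▸ T.1.zeros⟩, by
          have h := T.2
          rwa [mstContent, hc] at h⟩
      invFun := fun T => ⟨⟨T.1, hc.symm ▸ T.2.1.1, hc.symm ▸ T.2.1.2.1, hc.symm ▸ T.2.1.2.2.1,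
        hc.symm ▸ T.2.1.2.2.2.1, hc.symm ▸ T.2.1.2.2.2.2⟩,
        (Finset.sum_congr hc fun _ _ => rfl).trans T.2.2⟩
      left_inv := fun _ => rfl
      right_inv := fun _ => rfl }

theorem coeff_schurP (K : Type*) [Field K] [CharZero K] (l : StrictPtn) (e : ℕ →₀ ℕ) {a : ℕ}
    (ha : ∀ n, a ≤ n → e n = 0) :
    MvPowerSeries.coeff e (schurP K l) =
      MvPowerSeries.coeff e (chainSum (pWeight _) MvPowerSeries.X a (predParts l)) := by
  have h2 : (2 : K) ^ len l.1 ≠ 0 := pow_ne_zero _ two_ne_zero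
  rw [schurP, MvPowerSeries.coeff_smul, coeff_schurQ K l e ha, ← chainSum_pWeight, card_predParts]
  have : (2 : MvPowerSeries ℕ K) ^ len l.1 = MvPowerSeries.C (2 ^ len l.1) := by
    rw [map_pow, map_ofNat]
  rw [this, MvPowerSeries.coeff_C_mul, inv_mul_cancel_left₀ h2]

end ShiftedCauchy

/-! ### The infinite product and passage to infinitely many variables -/

section CauchyKernel

variable {K : Type*} [Field K]

/-- The part of an exponent that belongs to the first alphabet. -/
def xPart (e : ℕ ⊕ ℕ →₀ ℕ) : ℕ →₀ ℕ := e.comapDomain Sum.inl Sum.inl_injective.injOn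

/-- The part of an exponent that belongs to the second alphabet. -/
def yPart (e : ℕ ⊕ ℕ →₀ ℕ) : ℕ →₀ ℕ := e.comapDomain Sum.inr Sum.inr_injective.injOn

@[simp] theorem xPart_apply (e : ℕ ⊕ ℕ →₀ ℕ) (i : ℕ) : xPart e i = e (Sum.inl i) := rfl

@[simp] theorem yPart_apply (e : ℕ ⊕ ℕ →₀ ℕ) (i : ℕ) : yPart e i = e (Sum.inr i) := rfl

/-- The total degree in the first alphabet. -/
def xDegree : (ℕ ⊕ ℕ →₀ ℕ) →+ ℕ :=
  Finsupp.degree.comp (Finsupp.comapDomain.addMonoidHom Sum.inl_injective)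

theorem xDegree_apply (e : ℕ ⊕ ℕ →₀ ℕ) : xDegree e = (xPart e).degree := rfl

/-- The alphabets are disjoint, so an exponent splits in only one way into an `x` part and a `y`
part. -/
theorem coeff_inX_mul_inY (f g : MvPowerSeries ℕ K) (e : ℕ ⊕ ℕ →₀ ℕ) :
    MvPowerSeries.coeff e (inX f * inY g) =
      MvPowerSeries.coeff (xPart e) f * MvPowerSeries.coeff (yPart e) g := by
  classical
  rw [MvPowerSeries.coeff_mul, sum_eq_single (Finsupp.embDomain Function.Embedding.inl (xPart e),
    Finsupp.embDomain Function.Embedding.inr (yPart e))]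
  · rw [inX, inY, MvPowerSeries.coeff_embDomain_rename, MvPowerSeries.coeff_embDomain_rename]
  · rintro ⟨u, v⟩ huv hne
    rw [HasAntidiagonal.mem_antidiagonal] at huv
    by_contra h
    obtain ⟨u', rfl⟩ := not_not.1 fun h' =>
      left_ne_zero_of_mul h (MvPowerSeries.coeff_rename_eq_zero _ _ h')
    obtain ⟨v', rfl⟩ := not_not.1 fun h' =>
      right_ne_zero_of_mul h (MvPowerSeries.coeff_rename_eq_zero _ _ h')
    rw [← Finsupp.embDomain_eq_mapDomain, ← Finsupp.embDomain_eq_mapDomain] at huv hne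
    apply hne
    subst huv
    congr 2 <;> ext i <;> simp
  · intro h
    exfalso
    apply h
    rw [HasAntidiagonal.mem_antidiagonal]
    ext i
    rcases i with i | i <;> simp

/-- The series `p` in an additional variable is obtained from `f` by recording the degree in the
first alphabet. -/
def Homogenizes (p : PowerSeries (MvPowerSeries (ℕ ⊕ ℕ) K)) (f : MvPowerSeries (ℕ ⊕ ℕ) K) : Prop :=
  ∀ n e, MvPowerSeries.coeff e (PowerSeries.coeff n p) =
    if xDegree e = n then MvPowerSeries.coeff e f else 0

namespace Homogenizes

variable {p q : PowerSeries (MvPowerSeries (ℕ ⊕ ℕ) K)} {f g : MvPowerSeries (ℕ ⊕ ℕ) K}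

/-- This replaces setting the auxiliary variable equal to 1: each coefficient of `f` is found in
exactly one degree of `p`. -/
theorem unique (h : Homogenizes p f) (h' : Homogenizes p g) : f = g := by
  ext e
  have := (h (xDegree e) e).symm.trans (h' (xDegree e) e)
  simpa using this

theorem one : Homogenizes (K := K) 1 1 := by
  classical
  intro n e
  rw [PowerSeries.coeff_one, MvPowerSeries.coeff_one]
  by_cases he : e = 0
  · subst he
    rw [map_zero]
    simp only [eq_comm (a := n)]
    split_ifs <;> simp
  · split_ifs <;> simp [MvPowerSeries.coeff_one, he]

theorem add (h : Homogenizes p f) (h' : Homogenizes q g) : Homogenizes (p + q) (f + g) := by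
  intro n e
  rw [map_add, map_add, map_add, h, h']
  split_ifs <;> simp

theorem sub (h : Homogenizes p f) (h' : Homogenizes q g) : Homogenizes (p - q) (f - g) := by
  intro n e
  rw [map_sub, map_sub, map_sub, h, h']
  split_ifs <;> simp

theorem mul (h : Homogenizes p f) (h' : Homogenizes q g) : Homogenizes (p * q) (f * g) := by
  classical
  intro n e
  rw [PowerSeries.coeff_mul, map_sum]
  simp only [MvPowerSeries.coeff_mul]
  rw [sum_comm]
  have : ∀ uv ∈ antidiagonal e, ∑ ab ∈ antidiagonal n,
      MvPowerSeries.coeff uv.1 (PowerSeries.coeff ab.1 p) *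
        MvPowerSeries.coeff uv.2 (PowerSeries.coeff ab.2 q) =
      if xDegree e = n then MvPowerSeries.coeff uv.1 f * MvPowerSeries.coeff uv.2 g else 0 := by
    intro uv huv
    rw [HasAntidiagonal.mem_antidiagonal] at huv
    have hd : xDegree e = xDegree uv.1 + xDegree uv.2 := by rw [← huv, map_add]
    split_ifs with hn
    · rw [sum_eq_single (xDegree uv.1, xDegree uv.2)]
      · rw [h, h', if_pos rfl, if_pos rfl]
      · rintro ⟨a, b⟩ hab hne
        rw [h, h']
        by_cases ha : xDegree uv.1 = a
        · by_cases hb : xDegree uv.2 = b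
          · exact absurd (Prod.ext ha.symm hb.symm) hne
          · simp [hb]
        · simp [ha]
      · intro hm
        rw [HasAntidiagonal.mem_antidiagonal] at hm
        exact absurd (hd.symm.trans hn) hm
    · refine sum_eq_zero ?_
      rintro ⟨a, b⟩ hab
      rw [HasAntidiagonal.mem_antidiagonal] at hab
      rw [h, h']
      by_cases ha : xDegree uv.1 = a
      · by_cases hb : xDegree uv.2 = b
        · simp only at hab
          omega
        · simp [hb]
      · simp [ha]
  rw [sum_congr rfl this]
  split_ifs <;> simp

theorem prod {ι : Type*} {s : Finset ι} {p : ι → PowerSeries (MvPowerSeries (ℕ ⊕ ℕ) K)}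
    {f : ι → MvPowerSeries (ℕ ⊕ ℕ) K} (h : ∀ i ∈ s, Homogenizes (p i) (f i)) :
    Homogenizes (∏ i ∈ s, p i) (∏ i ∈ s, f i) := by
  classical
  induction s using Finset.induction_on with
  | empty => simpa using one
  | insert a s ha ih =>
    rw [prod_insert ha, prod_insert ha]
    exact (h a (mem_insert_self a s)).mul (ih fun i hi => h i (mem_insert_of_mem hi))

end Homogenizes

/-- The exponent of `xᵢ yⱼ`. -/
def pairExponent (i j : ℕ) : ℕ ⊕ ℕ →₀ ℕ :=
  Finsupp.single (Sum.inl i) 1 + Finsupp.single (Sum.inr j) 1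

@[simp] theorem pairExponent_inl (i j : ℕ) : pairExponent i j (Sum.inl i) = 1 := by
  simp [pairExponent]

@[simp] theorem pairExponent_inr (i j : ℕ) : pairExponent i j (Sum.inr j) = 1 := by
  simp [pairExponent]

theorem xDegree_pairExponent (i j : ℕ) : xDegree (pairExponent i j) = 1 := by
  have : xPart (pairExponent i j) = Finsupp.single i 1 := by
    ext a
    simp [pairExponent, Finsupp.single_apply]
  rw [xDegree_apply, this, Finsupp.degree_single]

theorem X_mul_X_eq_monomial (i j : ℕ) :
    (MvPowerSeries.X (Sum.inl i) * MvPowerSeries.X (Sum.inr j) : MvPowerSeries (ℕ ⊕ ℕ) K) =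
      MvPowerSeries.monomial (pairExponent i j) 1 := by
  rw [MvPowerSeries.X, MvPowerSeries.X, MvPowerSeries.monomial_mul_monomial, one_mul, pairExponent]

/-- The series `∑ₙ kₙ (xᵢ yⱼ)ⁿ`. -/
def kernelSeries (k : ℕ → K) (i j : ℕ) : MvPowerSeries (ℕ ⊕ ℕ) K := fun e =>
  open Classical in if e = e (Sum.inl i) • pairExponent i j then k (e (Sum.inl i)) else 0

open Classical in
theorem coeff_kernelSeries (k : ℕ → K) (i j : ℕ) (e : ℕ ⊕ ℕ →₀ ℕ) :
    MvPowerSeries.coeff e (kernelSeries k i j) =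
      if e = e (Sum.inl i) • pairExponent i j then k (e (Sum.inl i)) else 0 := rfl

theorem homogenizes_kernelSeries (k : ℕ → K) (i j : ℕ) :
    Homogenizes (PowerSeries.rescale (MvPowerSeries.X (Sum.inl i) * MvPowerSeries.X (Sum.inr j))
      (PowerSeries.mk fun n => MvPowerSeries.C (k n))) (kernelSeries k i j) := by
  classical
  intro n e
  rw [PowerSeries.coeff_rescale, PowerSeries.coeff_mk, X_mul_X_eq_monomial,
    MvPowerSeries.monomial_pow, one_pow, mul_comm, MvPowerSeries.coeff_C_mul,
    MvPowerSeries.coeff_monomial, coeff_kernelSeries]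
  by_cases he : e = e (Sum.inl i) • pairExponent i j
  · have h1 : xDegree e = e (Sum.inl i) := by
      conv_lhs => rw [he]
      rw [map_nsmul, xDegree_pairExponent]
      simp
    rw [if_pos he, h1]
    by_cases hn : e (Sum.inl i) = n
    · rw [if_pos hn, if_pos (by rw [← hn]; exact he), hn, mul_one]
    · rw [if_neg hn, if_neg, mul_zero]
      rintro rfl
      exact hn (by simp)
  · rw [if_neg he, if_neg, mul_zero, ite_self]
    rintro rfl
    exact he (by simp)

theorem homogenizes_X_mul_X (i j : ℕ) : Homogenizes (K := K)
    (PowerSeries.C (MvPowerSeries.X (Sum.inl i) * MvPowerSeries.X (Sum.inr j)) * PowerSeries.X)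
    (MvPowerSeries.X (Sum.inl i) * MvPowerSeries.X (Sum.inr j)) := by
  classical
  intro n e
  rw [PowerSeries.coeff_C_mul, PowerSeries.coeff_X, X_mul_X_eq_monomial]
  by_cases hn : n = 1
  · subst hn
    rw [if_pos rfl, mul_one, MvPowerSeries.coeff_monomial]
    split_ifs with h1 h2 h2
    · rfl
    · rw [h1, xDegree_pairExponent] at h2
      exact absurd rfl h2
    · rfl
    · rfl
  · rw [if_neg hn, mul_zero, map_zero, MvPowerSeries.coeff_monomial]
    split_ifs with h1 h2
    · rw [h2, xDegree_pairExponent] at h1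
      exact absurd h1.symm hn
    · rfl
    · rfl

theorem one_sub_mul_kernelSeries_one (i j : ℕ) :
    (1 - MvPowerSeries.X (Sum.inl i) * MvPowerSeries.X (Sum.inr j)) *
      kernelSeries (fun _ => (1 : K)) i j = 1 := by
  refine Homogenizes.unique ((Homogenizes.one.sub (homogenizes_X_mul_X i j)).mul
    (homogenizes_kernelSeries _ i j)) ?_
  have h := congrArg (PowerSeries.rescale
    (MvPowerSeries.X (Sum.inl i) * MvPowerSeries.X (Sum.inr j) : MvPowerSeries (ℕ ⊕ ℕ) K))
    (PowerSeries.mk_one_mul_one_sub_eq_one (MvPowerSeries (ℕ ⊕ ℕ) K))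
  rw [map_mul, map_sub, map_one, PowerSeries.rescale_X, mul_comm] at h
  have e : (PowerSeries.mk fun _ => MvPowerSeries.C (1 : K)) =
      (PowerSeries.mk 1 : PowerSeries (MvPowerSeries (ℕ ⊕ ℕ) K)) := by
    ext1 n
    simp
  rw [e, h]
  exact Homogenizes.one

theorem one_sub_mul_kernelSeries_qKernel (i j : ℕ) :
    (1 - MvPowerSeries.X (Sum.inl i) * MvPowerSeries.X (Sum.inr j)) *
      kernelSeries (qKernel K) i j =
      1 + MvPowerSeries.X (Sum.inl i) * MvPowerSeries.X (Sum.inr j) := by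
  refine Homogenizes.unique ((Homogenizes.one.sub (homogenizes_X_mul_X i j)).mul
    (homogenizes_kernelSeries _ i j)) ?_
  have h := congrArg (PowerSeries.rescale
    (MvPowerSeries.X (Sum.inl i) * MvPowerSeries.X (Sum.inr j) : MvPowerSeries (ℕ ⊕ ℕ) K))
    (one_sub_X_mul_mk_qKernel (MvPowerSeries (ℕ ⊕ ℕ) K))
  rw [map_mul, map_sub, map_add, map_one, PowerSeries.rescale_X] at h
  have e : (PowerSeries.mk fun n => MvPowerSeries.C (qKernel K n)) =
      (PowerSeries.mk (qKernel _) : PowerSeries (MvPowerSeries (ℕ ⊕ ℕ) K)) := by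
    ext1 n
    simp only [PowerSeries.coeff_mk, qKernel]
    split_ifs
    · simp
    · rw [map_ofNat]
  rw [e, h]
  exact Homogenizes.one.add (homogenizes_X_mul_X i j)

theorem coeff_mul_of_coeff_eq_one {f g : MvPowerSeries (ℕ ⊕ ℕ) K} {e : ℕ ⊕ ℕ →₀ ℕ}
    (h : ∀ u ≤ e, u ≠ 0 → MvPowerSeries.coeff u g = 0) (h0 : MvPowerSeries.coeff 0 g = 1) :
    MvPowerSeries.coeff e (f * g) = MvPowerSeries.coeff e f := by
  classical
  rw [MvPowerSeries.coeff_mul, sum_eq_single (e, 0)]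
  · rw [h0, mul_one]
  · rintro ⟨u, v⟩ huv hne
    rw [HasAntidiagonal.mem_antidiagonal] at huv
    simp only at huv
    rw [h v (huv ▸ le_add_self), mul_zero]
    rintro rfl
    rw [add_zero] at huv
    exact hne (by rw [huv])
  · intro hm
    exfalso
    apply hm
    simp [HasAntidiagonal.mem_antidiagonal]

/-- If `xᵢ` or `yⱼ` is absent from the monomial, only the constant term 1 of the factor can
contribute. Thus every coefficient of the infinite product stabilises. -/
theorem coeff_mul_kernelSeries {k : ℕ → K} (hk : k 0 = 1) (f : MvPowerSeries (ℕ ⊕ ℕ) K)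
    {e : ℕ ⊕ ℕ →₀ ℕ} {i j : ℕ} (h : e (Sum.inl i) = 0 ∨ e (Sum.inr j) = 0) :
    MvPowerSeries.coeff e (f * kernelSeries k i j) = MvPowerSeries.coeff e f := by
  refine coeff_mul_of_coeff_eq_one (fun u hu hne => ?_) ?_
  · rw [coeff_kernelSeries, if_neg]
    intro h1
    have h2 : u (Sum.inl i) = 0 := by
      rcases h with h | h
      · have := hu (Sum.inl i)
        omega
      · have h3 := DFunLike.congr_fun h1 (Sum.inr j)
        have := hu (Sum.inr j)
        simp only [Finsupp.smul_apply, pairExponent_inr, smul_eq_mul, mul_one] at h3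
        omega
    rw [h2, zero_smul] at h1
    exact hne h1
  · rw [coeff_kernelSeries]
    simp [hk]

theorem coeff_mul_prod_kernelSeries {k : ℕ → K} (hk : k 0 = 1) (f : MvPowerSeries (ℕ ⊕ ℕ) K)
    {e : ℕ ⊕ ℕ →₀ ℕ} (s : Finset (ℕ × ℕ))
    (h : ∀ p ∈ s, e (Sum.inl p.1) = 0 ∨ e (Sum.inr p.2) = 0) :
    MvPowerSeries.coeff e (f * ∏ p ∈ s, kernelSeries k p.1 p.2) = MvPowerSeries.coeff e f := by
  induction s using Finset.induction_on with
  | empty => simp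
  | insert a s ha ih =>
    rw [prod_insert ha, mul_comm (kernelSeries _ _ _), ← mul_assoc,
      coeff_mul_kernelSeries hk _ (h a (mem_insert_self a s)),
      ih fun p hp => h p (mem_insert_of_mem hp)]

/-- A number such that only smaller indices occur in the exponent `e`. -/
def indexBound (e : ℕ ⊕ ℕ →₀ ℕ) : ℕ := e.support.sup (Sum.elim (· + 1) (· + 1))

theorem apply_eq_zero_of_indexBound_le {e : ℕ ⊕ ℕ →₀ ℕ} {i : ℕ} (h : indexBound e ≤ i) :
    e (Sum.inl i) = 0 ∧ e (Sum.inr i) = 0 := by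
  constructor <;>
  · by_contra hne
    have := (Finset.le_sup (f := Sum.elim (· + 1) (· + 1)) (Finsupp.mem_support_iff.2 hne)).trans h
    simp at this

/-- The infinite product of the series `kernelSeries k i j`. -/
def cauchyProduct (k : ℕ → K) : MvPowerSeries (ℕ ⊕ ℕ) K := fun e =>
  MvPowerSeries.coeff e
    (∏ p ∈ range (indexBound e) ×ˢ range (indexBound e), kernelSeries k p.1 p.2)

theorem coeff_prod_kernelSeries {k : ℕ → K} (hk : k 0 = 1) (e : ℕ ⊕ ℕ →₀ ℕ)
    {s : Finset (ℕ × ℕ)} (hs : range (indexBound e) ×ˢ range (indexBound e) ⊆ s) :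
    MvPowerSeries.coeff e (∏ p ∈ s, kernelSeries k p.1 p.2) =
      MvPowerSeries.coeff e (cauchyProduct k) := by
  rw [← prod_sdiff hs, mul_comm, coeff_mul_prod_kernelSeries hk]
  · rfl
  · intro p hp
    rw [mem_sdiff, mem_product, mem_range, mem_range, not_and_or, not_lt, not_lt] at hp
    rcases hp.2 with h | h
    · exact Or.inl (apply_eq_zero_of_indexBound_le h).1
    · exact Or.inr (apply_eq_zero_of_indexBound_le h).2

theorem hasProd_kernelSeries [TopologicalSpace K] {k : ℕ → K} (hk : k 0 = 1) :
    HasProd (fun p : ℕ × ℕ => kernelSeries k p.1 p.2) (cauchyProduct k) := by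
  rw [HasProd, MvPowerSeries.WithPiTopology.tendsto_iff_coeff_tendsto]
  intro e
  refine tendsto_const_nhds.congr' ?_
  rw [SummationFilter.unconditional_filter]
  filter_upwards [Filter.eventually_ge_atTop
    (range (indexBound e) ×ˢ range (indexBound e))] with s hs
  exact (coeff_prod_kernelSeries hk e hs).symm

theorem map_chainSum {P R R' : Type*} [GradedFinite P] [CommRing R] [CommRing R'] (f : R →+* R')
    {A : P → P → R} {A' : P → P → R'} (hA : ∀ l m, f (A l m) = A' l m) (x : ℕ → R) (n : ℕ) (l : P) :
    f (chainSum A x n l) = chainSum A' (fun i => f (x i)) n l := by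
  induction n generalizing l with
  | zero =>
    simp only [chainSum]
    split_ifs <;> simp
  | succ n ih => simp only [chainSum, raise, map_sum, map_mul, map_pow, hA, ih]

/-- For fixed `e`, `hu` truncates to the variables below `indexBound e`, and `hdeg` leaves only the
finite level of degree `xDegree e`. The finite Cauchy identity, read at that power of the auxiliary
variable, then gives the coefficient of the product. -/
theorem hasSum_cauchyProduct [TopologicalSpace K] {P ι : Type*} [GradedFinite P] {k : ℕ → K}
    (hk : k 0 = 1) {A B : P → P → MvPowerSeries (ℕ ⊕ ℕ) K}
    (hAB : StripCommute A B fun n => MvPowerSeries.C (k n)) {o : P}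
    (ho : ∀ l : P, GradedFinite.deg l = 0 ↔ l = o) (hA : A o o = 1) (hB : B o o = 1)
    (g : ι ≃ P) {u : ι → MvPowerSeries (ℕ ⊕ ℕ) K}
    (hu : ∀ i e, MvPowerSeries.coeff e (u i) = MvPowerSeries.coeff e
      (chainSum A (fun i => MvPowerSeries.X (Sum.inl i)) (indexBound e) (g i) *
        chainSum B (fun i => MvPowerSeries.X (Sum.inr i)) (indexBound e) (g i)))
    (hdeg : ∀ i e, MvPowerSeries.coeff e (u i) ≠ 0 → xDegree e = GradedFinite.deg (g i)) :
    HasSum u (cauchyProduct k) := by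
  rw [← Equiv.hasSum_iff g.symm, MvPowerSeries.WithPiTopology.hasSum_iff_hasSum_coeff]
  intro e
  have h1 := mk_sum_chainSum_mul_chainSum hAB ho hA hB (fun i => MvPowerSeries.X (Sum.inl i))
    (fun i => MvPowerSeries.X (Sum.inr i)) (indexBound e) (indexBound e)
  have h2 : Homogenizes (∏ j ∈ range (indexBound e), ∏ i ∈ range (indexBound e),
      PowerSeries.rescale (MvPowerSeries.X (Sum.inl i) * MvPowerSeries.X (Sum.inr j))
      (PowerSeries.mk fun n => MvPowerSeries.C (k n)))
      (∏ j ∈ range (indexBound e), ∏ i ∈ range (indexBound e), kernelSeries k i j) :=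
    Homogenizes.prod fun j _ => Homogenizes.prod fun i _ => homogenizes_kernelSeries k i j
  have h3 := h2 (xDegree e) e
  rw [← h1, PowerSeries.coeff_mk, if_pos rfl, map_sum, prod_comm, ← prod_product',
    coeff_prod_kernelSeries hk e subset_rfl] at h3
  have hl : ∀ l, MvPowerSeries.coeff e ((u ∘ g.symm) l) = MvPowerSeries.coeff e
      (chainSum A (fun i => MvPowerSeries.X (Sum.inl i)) (indexBound e) l *
        chainSum B (fun i => MvPowerSeries.X (Sum.inr i)) (indexBound e) l) := fun l => by
    rw [Function.comp_apply, hu, Equiv.apply_symm_apply]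
  rw [sum_congr rfl fun l _ => (hl l).symm] at h3
  rw [← h3]
  refine hasSum_sum_of_ne_finset_zero fun l hm => ?_
  by_contra hne
  have := hdeg _ _ hne
  rw [Equiv.apply_symm_apply] at this
  exact hm (mem_level.2 this.symm)

end CauchyKernel

/-! ### Partitions as index sets -/

section Bijections

theorem ptn_ext {l m : Ptn} (h : l.2.parts = m.2.parts) : l = m := by
  obtain ⟨n, l⟩ := l
  obtain ⟨n', m⟩ := m
  obtain rfl : n = n' := by rw [← l.parts_sum, ← m.parts_sum]; exact congrArg _ h
  exact congrArg _ (Nat.Partition.ext h)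

/-- The partition with a given multiset of positive parts. -/
def ptnOfParts (s : Multiset ℕ) (hs : ∀ i ∈ s, 0 < i) : Ptn :=
  ⟨s.sum, { parts := s, parts_pos := fun {_} hi => hs _ hi, parts_sum := rfl }⟩

theorem rows_pos (l : Ptn) (i : ℕ) (hi : i ∈ rows l) : 0 < i :=
  l.2.parts_pos ((Multiset.mem_sort _).1 hi)

theorem rowLens_diagram (l : Ptn) : (diagram l).rowLens = rows l :=
  YoungDiagram.rowLens_ofRowLens_eq_self fun {i} hi => rows_pos l i hi

theorem bijective_diagram : Function.Bijective diagram := by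
  constructor
  · intro l m h
    have h1 : rows l = rows m := by rw [← rowLens_diagram, ← rowLens_diagram, h]
    apply ptn_ext
    have h2 := congrArg (fun L : List ℕ => (L : Multiset ℕ)) h1
    simpa [rows] using h2
  · intro μ
    refine ⟨ptnOfParts μ.rowLens fun i hi => μ.pos_of_mem_rowLens i hi, ?_⟩
    have h : rows (ptnOfParts μ.rowLens fun i hi => μ.pos_of_mem_rowLens i hi) = μ.rowLens := by
      have h1 := μ.rowLens_sorted.pairwise
      simp only [rows, ptnOfParts]
      rw [Multiset.coe_sort]
      exact List.mergeSort_of_pairwise (by simpa using h1)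
    rw [diagram]
    simp only [h]
    exact YoungDiagram.ofRowLens_to_rowLens_eq_self

theorem bijective_predParts : Function.Bijective predParts := by
  constructor
  · intro l m h
    apply Subtype.ext
    apply ptn_ext
    rw [Multiset.Nodup.ext l.2 m.2]
    intro a
    rcases Nat.eq_zero_or_pos a with rfl | ha
    · exact iff_of_false (fun h => lt_irrefl _ (l.1.2.parts_pos h))
        (fun h => lt_irrefl _ (m.1.2.parts_pos h))
    · obtain ⟨b, rfl⟩ := Nat.exists_eq_succ_of_ne_zero ha.ne'
      rw [Nat.succ_eq_add_one, ← mem_predParts, ← mem_predParts, h]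
  · intro A
    refine ⟨⟨ptnOfParts (A.map ⟨(· + 1), Nat.succ_injective⟩).val (by simp), Finset.nodup _⟩, ?_⟩
    ext a
    rw [mem_predParts]
    simp [ptnOfParts]

theorem count_redPart (l : Ptn) (i : ℕ) :
    (redPart l).1.2.parts.count i = l.2.parts.count i % 2 := by
  rw [Multiset.count_eq_of_nodup (redPart l).2]
  simp only [redPart, Finset.mem_val, Finset.mem_filter, Multiset.mem_toFinset]
  rcases Nat.even_or_odd (l.2.parts.count i) with h | h
  · rw [if_neg fun h' => (Nat.not_odd_iff_even.2 h) h'.2, Nat.even_iff.1 h]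
  · rw [if_pos ⟨Multiset.count_pos.1 h.pos, h⟩, Nat.odd_iff.1 h]

theorem count_doublePart (l : Ptn) (i : ℕ) :
    (doublePart l).2.parts.count i = l.2.parts.count i / 2 := by
  simp only [doublePart, Multiset.count_sum', Multiset.count_replicate]
  rw [Finset.sum_ite_eq']
  split_ifs with h
  · rfl
  · rw [Multiset.mem_toFinset] at h
    rw [Multiset.count_eq_zero_of_notMem h, Nat.zero_div]

/-- Every multiplicity is uniquely `r + 2d` with `r ≤ 1`. The inverse sends `(μ, ν)` to the union of
`μ` with two copies of `ν`. -/
theorem bijective_redPart_doublePart :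
    Function.Bijective fun l : Ptn => (redPart l, doublePart l) := by
  constructor
  · intro l m h
    rw [Prod.mk.injEq] at h
    apply ptn_ext
    ext i
    have h1 := count_redPart l i
    have h2 := count_doublePart l i
    rw [h.1, count_redPart] at h1
    rw [h.2, count_doublePart] at h2
    omega
  · rintro ⟨μ, ν⟩
    have hc (i : ℕ) : (μ.1.2.parts + 2 • ν.2.parts).count i =
        μ.1.2.parts.count i + 2 * ν.2.parts.count i := by
      rw [Multiset.count_add, Multiset.count_nsmul]
    have hμ (i : ℕ) : μ.1.2.parts.count i ≤ 1 := Multiset.nodup_iff_count_le_one.1 μ.2 i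
    refine ⟨ptnOfParts (μ.1.2.parts + 2 • ν.2.parts) fun i hi => ?_, ?_⟩
    · rcases Multiset.mem_add.1 hi with h | h
      · exact μ.1.2.parts_pos h
      · exact ν.2.parts_pos (Multiset.mem_of_mem_nsmul h)
    · refine Prod.ext (Subtype.ext (ptn_ext ?_)) (ptn_ext ?_)
      · ext i
        have := hμ i
        simp only [count_redPart, ptnOfParts, hc]
        omega
      · ext i
        have := hμ i
        simp only [count_doublePart, ptnOfParts, hc]
        omega

end Bijections

/-! ### Homogeneity of Schur and `Q`-functions -/

section Homogeneity

variable {K : Type*} [Field K]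

theorem degree_of_coeff_schurS_ne_zero {l : Ptn} {e : ℕ →₀ ℕ}
    (h : MvPowerSeries.coeff e (schurS K l) ≠ 0) : e.degree = (diagram l).card := by
  have h1 : Nat.card {T : SemistandardYoungTableau (diagram l) // ssytContent T = e} ≠ 0 := by
    intro h0
    apply h
    change ((Nat.card _ : ℕ) : K) = 0
    rw [h0, Nat.cast_zero]
  obtain ⟨⟨T, rfl⟩⟩ := (Nat.card_ne_zero.1 h1).1
  simp [ssytContent, map_sum, YoungDiagram.card]

theorem degree_of_coeff_schurQ_ne_zero {l : StrictPtn} {e : ℕ →₀ ℕ}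
    (h : MvPowerSeries.coeff e (schurQ K l) ≠ 0) : e.degree = GradedFinite.deg (predParts l) := by
  have h1 : Nat.card {T : MarkedShiftedTableau l // mstContent T = e} ≠ 0 := by
    intro h0
    apply h
    change ((Nat.card _ : ℕ) : K) = 0
    rw [h0, Nat.cast_zero]
  obtain ⟨⟨T, rfl⟩⟩ := (Nat.card_ne_zero.1 h1).1
  simp [mstContent, map_sum, deg_eq_card_shiftedDiagram, shiftedCells_eq]

theorem coeff_inX_mul_inY_ne_zero {f g : MvPowerSeries ℕ K} {e : ℕ ⊕ ℕ →₀ ℕ}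
    (h : MvPowerSeries.coeff e (inX f * inY g) ≠ 0) :
    MvPowerSeries.coeff (xPart e) f ≠ 0 := by
  rw [coeff_inX_mul_inY] at h
  exact left_ne_zero_of_mul h

end Homogeneity

/-! ### The two Cauchy identities -/

section Cauchy

variable {K : Type*} [Field K]

theorem inX_chainSum {P : Type*} [GradedFinite P] {A : P → P → MvPowerSeries ℕ K}
    {A' : P → P → MvPowerSeries (ℕ ⊕ ℕ) K} (hA : ∀ l m, inX (A l m) = A' l m) (n : ℕ) (l : P) :
    inX (chainSum A MvPowerSeries.X n l) =
      chainSum A' (fun i => MvPowerSeries.X (Sum.inl i)) n l := by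
  have := map_chainSum (MvPowerSeries.rename
    (Function.Embedding.inl : ℕ ↪ ℕ ⊕ ℕ) : MvPowerSeries ℕ K →ₐ[K]
      MvPowerSeries (ℕ ⊕ ℕ) K).toRingHom hA MvPowerSeries.X n l
  refine this.trans (congrArg (fun x => chainSum A' x n l) (funext fun i => ?_))
  exact MvPowerSeries.rename_X (R := K) (f := _) i

theorem inY_chainSum {P : Type*} [GradedFinite P] {A : P → P → MvPowerSeries ℕ K}
    {A' : P → P → MvPowerSeries (ℕ ⊕ ℕ) K} (hA : ∀ l m, inY (A l m) = A' l m) (n : ℕ) (l : P) :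
    inY (chainSum A MvPowerSeries.X n l) =
      chainSum A' (fun i => MvPowerSeries.X (Sum.inr i)) n l := by
  have := map_chainSum (MvPowerSeries.rename
    (Function.Embedding.inr : ℕ ↪ ℕ ⊕ ℕ) : MvPowerSeries ℕ K →ₐ[K]
      MvPowerSeries (ℕ ⊕ ℕ) K).toRingHom hA MvPowerSeries.X n l
  refine this.trans (congrArg (fun x => chainSum A' x n l) (funext fun i => ?_))
  exact MvPowerSeries.rename_X (R := K) (f := _) i

theorem coeff_inX_mul_inY_congr {f f' g g' : MvPowerSeries ℕ K} {e : ℕ ⊕ ℕ →₀ ℕ}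
    (hf : ∀ u : ℕ →₀ ℕ, (∀ n, indexBound e ≤ n → u n = 0) →
      MvPowerSeries.coeff u f = MvPowerSeries.coeff u f')
    (hg : ∀ u : ℕ →₀ ℕ, (∀ n, indexBound e ≤ n → u n = 0) →
      MvPowerSeries.coeff u g = MvPowerSeries.coeff u g') :
    MvPowerSeries.coeff e (inX f * inY g) = MvPowerSeries.coeff e (inX f' * inY g') := by
  rw [coeff_inX_mul_inY, coeff_inX_mul_inY,
    hf _ fun n hn => (apply_eq_zero_of_indexBound_le hn).1,
    hg _ fun n hn => (apply_eq_zero_of_indexBound_le hn).2]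

variable (K)

theorem hasSum_schurS [TopologicalSpace K] :
    HasSum (fun l : Ptn => inX (schurS K l) * inY (schurS K l))
      (cauchyProduct fun _ => (1 : K)) := by
  classical
  have hc : StripCommute (stripWeight (MvPowerSeries (ℕ ⊕ ℕ) K)) (stripWeight _)
      fun _ => MvPowerSeries.C (1 : K) := by
    simpa using stripCommute_stripWeight (MvPowerSeries (ℕ ⊕ ℕ) K)
  have h0 : stripWeight (MvPowerSeries (ℕ ⊕ ℕ) K) ⊥ ⊥ = 1 :=
    if_pos fun i => ⟨le_rfl, YoungDiagram.rowLen_anti _ _ _ (Nat.le_succ i)⟩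
  have hX (l m) : inX (stripWeight (MvPowerSeries ℕ K) l m) = stripWeight _ l m := by
    simp only [inX, stripWeight]
    split_ifs <;> simp
  have hY (l m) : inY (stripWeight (MvPowerSeries ℕ K) l m) = stripWeight _ l m := by
    simp only [inY, stripWeight]
    split_ifs <;> simp
  refine hasSum_cauchyProduct (k := fun _ => (1 : K)) rfl hc YoungDiagram.deg_eq_zero h0 h0
    (Equiv.ofBijective diagram bijective_diagram) (fun l e => ?_) fun l e he => ?_
  · rw [← inX_chainSum hX, ← inY_chainSum hY, ← genSum_ssytSystem]
    exact coeff_inX_mul_inY_congr (fun u hu => coeff_schurS K l u hu)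
      fun u hu => coeff_schurS K l u hu
  · rw [xDegree_apply, degree_of_coeff_schurS_ne_zero (coeff_inX_mul_inY_ne_zero he)]
    rfl

theorem hasSum_schurQ_schurP [CharZero K] [TopologicalSpace K] :
    HasSum (fun l : StrictPtn => inX (schurQ K l) * inY (schurP K l))
      (cauchyProduct (qKernel K)) := by
  classical
  have hk (n : ℕ) : MvPowerSeries.C (qKernel K n) = qKernel (MvPowerSeries (ℕ ⊕ ℕ) K) n := by
    simp only [qKernel]
    split_ifs
    · rw [map_one]
    · rw [map_ofNat]
  have hc : StripCommute (qWeight (MvPowerSeries (ℕ ⊕ ℕ) K)) (pWeight _)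
      fun n => MvPowerSeries.C (qKernel K n) := by
    simp only [hk]
    exact stripCommute_qWeight _
  have hX (l m) : inX (qWeight (MvPowerSeries ℕ K) l m) = qWeight _ l m := by
    simp only [inX, qWeight]
    split_ifs <;> simp [map_ofNat]
  have hY (l m) : inY (pWeight (MvPowerSeries ℕ K) l m) = pWeight _ l m := by
    simp only [inY, pWeight]
    split_ifs <;> simp [map_ofNat]
  refine hasSum_cauchyProduct (k := qKernel K) (if_pos rfl) hc deg_finset_eq_zero
    (by simp [qWeight, interlace_self]) (by simp [pWeight, interlace_self])
    (Equiv.ofBijective predParts bijective_predParts) (fun l e => ?_) fun l e he => ?_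
  · rw [← inX_chainSum hX, ← inY_chainSum hY]
    exact coeff_inX_mul_inY_congr (fun u hu => coeff_schurQ K l u hu)
      fun u hu => coeff_schurP K l u hu
  · rw [xDegree_apply, degree_of_coeff_schurQ_ne_zero (coeff_inX_mul_inY_ne_zero he)]
    rfl

end Cauchy

/-! ### Factorization of the kernel and conclusion -/

section Factor

variable {K : Type*} [Field K]

/-- With `t = xᵢyⱼ` this is `(1 - t)⁻² = (1 + t)/(1 - t) · 1/(1 - t²)`; `expand 2` replaces `t` by
`t²`. -/
theorem inv_one_sub_X_mul_X_sq (i j : ℕ) :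
    (((1 - MvPowerSeries.X (Sum.inl i) * MvPowerSeries.X (Sum.inr j)) ^ 2)⁻¹ :
      MvPowerSeries (ℕ ⊕ ℕ) K) = kernelSeries (qKernel K) i j *
        MvPowerSeries.expand 2 two_ne_zero (kernelSeries (fun _ => (1 : K)) i j) := by
  have h1 := one_sub_mul_kernelSeries_qKernel (K := K) i j
  have h2 := congrArg (MvPowerSeries.expand 2 two_ne_zero)
    (one_sub_mul_kernelSeries_one (K := K) i j)
  rw [map_mul, map_sub, map_mul, map_one, MvPowerSeries.expand_X, MvPowerSeries.expand_X] at h2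
  symm
  rw [MvPowerSeries.eq_inv_iff_mul_eq_one (by simp)]
  linear_combination (1 - MvPowerSeries.X (Sum.inl i) * MvPowerSeries.X (Sum.inr j)) *
    MvPowerSeries.expand 2 two_ne_zero (kernelSeries (fun _ => (1 : K)) i j) * h1 + h2

theorem rename_expand {σ τ : Type*} (i : σ ↪ τ) {p : ℕ} (hp : p ≠ 0) (f : MvPowerSeries σ K) :
    MvPowerSeries.rename i (MvPowerSeries.expand p hp f) =
      MvPowerSeries.expand p hp (MvPowerSeries.rename i f) := by
  have hi := MvPowerSeries.HasSubst.X_comp (R := K) (f := i)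
  rw [MvPowerSeries.rename_eq_subst, MvPowerSeries.rename_eq_subst,
    MvPowerSeries.expand_subst p hp hi, MvPowerSeries.expand, MvPowerSeries.substAlgHom_apply,
    MvPowerSeries.subst_comp_subst_apply (MvPowerSeries.HasSubst.X_pow hp) hi]
  congr 1
  funext a
  rw [MvPowerSeries.subst_pow hi, MvPowerSeries.subst_X hi, Function.comp_apply,
    MvPowerSeries.expand_X]

/-- Each coefficient of the expansion is either a coefficient of the original series or zero, so no
topological assumption on the field operations is needed. -/
theorem continuous_expand {σ : Type*} [TopologicalSpace K] {p : ℕ} (hp : p ≠ 0) : Continuous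
    (MvPowerSeries.expand p hp : MvPowerSeries σ K →ₐ[K] MvPowerSeries σ K) := by
  refine continuous_pi fun e => ?_
  change Continuous fun f => MvPowerSeries.coeff e (MvPowerSeries.expand p hp f)
  by_cases h : ∀ i, p ∣ e i
  · obtain ⟨u, rfl⟩ : ∃ u : σ →₀ ℕ, e = p • u := by
      refine ⟨e.mapRange (· / p) (Nat.zero_div p), ?_⟩
      ext i
      simp [Nat.mul_div_cancel' (h i)]
    simp only [MvPowerSeries.coeff_expand_smul]
    exact MvPowerSeries.WithPiTopology.continuous_coeff K u
  · obtain ⟨i, hi⟩ := not_forall.1 h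
    simp only [MvPowerSeries.coeff_expand_of_not_dvd p hp _ hi]
    exact continuous_const

/-- An exponent has finitely many decompositions `u + v`, and for each of them only finitely many
`f` and finitely many `g` have a nonzero coefficient. -/
theorem summable_mul_of_discreteTopology [TopologicalSpace K] [DiscreteTopology K] {σ ι κ : Type*}
    {f : ι → MvPowerSeries σ K} {g : κ → MvPowerSeries σ K} (hf : Summable f) (hg : Summable g) :
    Summable fun x : ι × κ => f x.1 * g x.2 := by
  classical
  rw [MvPowerSeries.WithPiTopology.summable_iff_summable_coeff] at hf hg ⊢
  intro e
  refine summable_of_hasFiniteSupport ?_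
  refine ((antidiagonal e).finite_toSet.biUnion fun uv _ =>
    (hf uv.1).hasFiniteSupport_of_discreteTopology.prod
      (hg uv.2).hasFiniteSupport_of_discreteTopology).subset fun x hx => ?_
  rw [Function.mem_support, MvPowerSeries.coeff_mul] at hx
  obtain ⟨uv, h1, h2⟩ := exists_ne_zero_of_sum_ne_zero hx
  exact Set.mem_biUnion h1 ⟨left_ne_zero_of_mul h2, right_ne_zero_of_mul h2⟩

variable (K)

theorem inX_W_mul_inY_V (l : Ptn) : inX (W K l) * inY (V K l) =
    inX (schurQ K (redPart l)) * inY (schurP K (redPart l)) *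
      MvPowerSeries.expand 2 two_ne_zero
        (inX (schurS K (doublePart l)) * inY (schurS K (doublePart l))) := by
  simp only [W, V, inX, inY, map_mul, rename_expand]
  ring

theorem hasProd_hasSum_of_discreteTopology [CharZero K] [TopologicalSpace K] [DiscreteTopology K] :
    ∃ F : MvPowerSeries (ℕ ⊕ ℕ) K,
      HasProd (fun p : ℕ × ℕ => (((1 - MvPowerSeries.X (Sum.inl p.1) *
        MvPowerSeries.X (Sum.inr p.2)) ^ 2)⁻¹ : MvPowerSeries (ℕ ⊕ ℕ) K)) F ∧
      HasSum (fun l : Ptn => inX (W K l) * inY (V K l)) F := by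
  have hc := continuous_expand (K := K) (σ := ℕ ⊕ ℕ) (two_ne_zero : (2 : ℕ) ≠ 0)
  refine ⟨cauchyProduct (qKernel K) *
    MvPowerSeries.expand 2 two_ne_zero (cauchyProduct fun _ => (1 : K)), ?_, ?_⟩
  · simp only [inv_one_sub_X_mul_X_sq]
    have h1 := hasProd_kernelSeries (k := qKernel K) (if_pos rfl)
    have h2 := (hasProd_kernelSeries (k := fun _ => (1 : K)) rfl).map
        (MvPowerSeries.expand 2 two_ne_zero : MvPowerSeries (ℕ ⊕ ℕ) K →ₐ[K] _) hc
    exact h1.mul h2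
  · have hQ := hasSum_schurQ_schurP K
    have hS := HasSum.map (hasSum_schurS K)
      (MvPowerSeries.expand 2 two_ne_zero : MvPowerSeries (ℕ ⊕ ℕ) K →ₐ[K] _) hc
    have hm := summable_mul_of_discreteTopology hQ.summable hS.summable
    have h := HasSum.mul hQ hS hm
    -- The double sum over a strict partition and an arbitrary one becomes a sum over all
    -- partitions.
    rw [← (Equiv.ofBijective _ bijective_redPart_doublePart).hasSum_iff] at h
    rw [funext (inX_W_mul_inY_V K)]
    exact h

/-- Multiplication on `K` need not be continuous for the given topology. The discrete topology is
the finest, so convergence for it implies convergence for any other. -/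
theorem hasProd_hasSum [CharZero K] [t : TopologicalSpace K] :
    ∃ F : MvPowerSeries (ℕ ⊕ ℕ) K,
      HasProd (fun p : ℕ × ℕ => (((1 - MvPowerSeries.X (Sum.inl p.1) *
        MvPowerSeries.X (Sum.inr p.2)) ^ 2)⁻¹ : MvPowerSeries (ℕ ⊕ ℕ) K)) F ∧
      HasSum (fun l : Ptn => inX (W K l) * inY (V K l)) F := by
  obtain ⟨F, h1, h2⟩ := @hasProd_hasSum_of_discreteTopology K _ _ ⊥ (@DiscreteTopology.mk K ⊥ rfl)
  have h : @nhds _ (@MvPowerSeries.WithPiTopology.instTopologicalSpace (ℕ ⊕ ℕ) K ⊥) F ≤ nhds F :=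
    nhds_mono (MvPowerSeries.WithPiTopology.instTopologicalSpace_mono (ℕ ⊕ ℕ) bot_le)
  exact ⟨F, le_trans h1 h, le_trans h2 h⟩

end Factor

end CompoundBasis

end

/-- The topology on power series is that of coefficientwise convergence. Since the Hausdorff
topology on `K` is arbitrary, the discrete one (formal convergence: every coefficient is eventually
constant) and the usual one on `ℂ` are both covered. -/
theorem proposition4p1 (K : Type*) [Field K] [CharZero K] [TopologicalSpace K] [T2Space K] :
    Multipliable (fun p : ℕ × ℕ =>
      (((1 - MvPowerSeries.X (Sum.inl p.1) * MvPowerSeries.X (Sum.inr p.2)) ^ 2)⁻¹ :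
        MvPowerSeries (ℕ ⊕ ℕ) K)) ∧
    Summable (fun l : CompoundBasis.Ptn =>
      CompoundBasis.inX (CompoundBasis.W K l) * CompoundBasis.inY (CompoundBasis.V K l)) ∧
    ∏' p : ℕ × ℕ,
      (((1 - MvPowerSeries.X (Sum.inl p.1) * MvPowerSeries.X (Sum.inr p.2)) ^ 2)⁻¹ :
        MvPowerSeries (ℕ ⊕ ℕ) K) =
      ∑' l : CompoundBasis.Ptn,
        CompoundBasis.inX (CompoundBasis.W K l) * CompoundBasis.inY (CompoundBasis.V K l) := by
  obtain ⟨F, h1, h2⟩ := CompoundBasis.hasProd_hasSum K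
  exact ⟨h1.multipliable, h2.summable, h1.tprod_eq.trans h2.tsum_eq.symm⟩
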